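/- **Setting.** Let $(X_i,Y_i)$, $i\ge 1$, be i.i.d. pairs of real random variables with $E|Y_1|<\infty$ and regression function $m(x)=E(Y_1\mid X_1=x)$, where $X_1$ has a density $f$ that is supported on $\mathcal I=[0,1]$. Let $K$ be a symmetric, Lipschitz continuous probability density on $\mathbb R$ supported on $[-1,1]$, put $K_h(u)=K(u/h)/h$, and let the bandwidths $h=h_n>0$ satisfy $h\to0$ and $nh/\log n\to\infty$. For data $(x_i,y_i)_{i\le n}$ the Nadaraya–Watson smoother is $\sum_i K_h(x_i-x)y_i\big/\sum_i K_h(x_i-x)$. Let $\hat m_0$ be the smoother of $(X_i,Y_i)_{i\le n}$, and for $r\ge1$ let $\hat m_r=\hat m_{r-1}+{}$the smoother of $(X_i,\,Y_i-\hat m_{r-1}(X_i))_{i\le n}$ ($L_2$ boosting). Write $\lfloor s\rfloor$ for the largest integer that is *strictly* less than $s$. For $s>0$ let $\mathcal F(s,C)$ be the class of functions $g$ that are $\lfloor s\rfloor$ times continuously differentiable on $\mathcal I$ with $|g^{(\lfloor s\rfloor)}(x)-g^{(\lfloor s\rfloor)}(x')|\le C|x-x'|^{s-\lfloor s\rfloor}$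 for all $x,x'\in\mathcal I$. **Theorem 3.** Assume that $m\in\mathcal F(\nu,C_1)$ and $f\in\mathcal F(\nu-1,C_2)$ with $\nu\ge2$, and that $\inf_{x\in\mathcal I}f(x)>0$. Let $r\ge\lfloor\nu/2\rfloor$ be a nonnegative integer. Then, for every $\varepsilon>0$, uniformly for $x\in[\varepsilon,1-\varepsilon]$, $$E[\hat m_r(x)\mid X_1,\dots,X_n]-m(x)=O_p\Big(h^\nu+\sqrt{\tfrac{h\log n}{n}}\Big).$$ If moreover $E Y_1^2<\infty$ and the conditional variance $\operatorname{Var}(Y_1\mid X_1)$ is almost surely bounded by a constant, then, for every $\varepsilon>0$, uniformly for $x\in[\varepsilon,1-\varepsilon]$, $$E[(\hat m_r(x)-m(x))^2\mid X_1,\dots,X_n]=O_p\big(n^{-1}h^{-1}+h^{2\nu}\big);$$ in particular, if $h\asymp n^{-1/(2\nu+1)}$, the conditional root mean squared error $\big(E[(\hat m_r(x)-m(x))^2\mid X_1,\dots,X_n]\big)^{1/2}$ is $O_p(n^{-\nu/(2\nu+1)})$ uniformly for $x\in[\varepsilon,1-\varepsilon]$. Here conditional expectations given $X_1,\dots,X_n$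 are taken with respect to a regular conditional distribution of $(Y_1,\dots,Y_n)$, and $Z_n(x)=O_p(a_n)$ uniformly for $x\in S$ means that for every $\eta>0$ there is $M$ with $P(\sup_{x\in S}|Z_n(x)|>Ma_n)\le\eta$ for all large $n$. -/

import Mathlib

open MeasureTheory ProbabilityTheory Filter Topology Set

/-- The largest natural number that is strictly less than `s`, for real `s > 0`. -/
noncomputable def strictFloor (s : ℝ) : ℕ := ⌈s⌉₊ - 1

/-- The Hölder class of order `s > 0` with constant `C` on `[0, 1]`: with `k` the largest integer
strictly less than `s`, the function is `k` times continuously differentiable on `[0, 1]`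
(one-sided derivatives at the endpoints) and its `k`-th derivative is Hölder continuous there
with exponent `s - k` and constant `C`. -/
def HolderClass (s C : ℝ) : Set (ℝ → ℝ) :=
  {g | ContDiffOn ℝ (strictFloor s : ℕ) g (Icc 0 1) ∧
    ∀ x ∈ Icc (0 : ℝ) 1, ∀ x' ∈ Icc (0 : ℝ) 1,
      |iteratedDerivWithin (strictFloor s) g (Icc 0 1) x -
        iteratedDerivWithin (strictFloor s) g (Icc 0 1) x'| ≤
          C * |x - x'| ^ (s - (strictFloor s : ℝ))}

/-- A smoothing kernel: a symmetric probability density on the line which is Lipschitz continuous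
and vanishes outside `[-1, 1]`. -/
structure IsSmoothingKernel (K : ℝ → ℝ) : Prop where
  nonneg : ∀ u, 0 ≤ K u
  integral_eq_one : ∫ u, K u = 1
  symm : ∀ u, K (-u) = K u
  lipschitz : ∃ L, LipschitzWith L K
  support : ∀ u, u ∉ Icc (-1 : ℝ) 1 → K u = 0

/-- The rescaled kernel `K_h(u) = K(u / h) / h`. -/
noncomputable def scaledKernel (K : ℝ → ℝ) (h u : ℝ) : ℝ := K (u / h) / h

/-- The Nadaraya-Watson smoother at `x`, computed from covariates `xs` and responses `ys`. -/
noncomputable def nadarayaWatson (K : ℝ → ℝ) (h : ℝ) {n : ℕ} (xs ys : Fin n → ℝ) (x : ℝ) : ℝ :=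
  (∑ i, scaledKernel K h (xs i - x) * ys i) / ∑ i, scaledKernel K h (xs i - x)

/-- `L₂` boosting of the Nadaraya-Watson smoother after `r` steps: start from the smoother of the
data, and at every step add the smoother of the current residuals. -/
noncomputable def boostedNW (K : ℝ → ℝ) (h : ℝ) {n : ℕ} (xs ys : Fin n → ℝ) : ℕ → ℝ → ℝ
  | 0 => fun x => nadarayaWatson K h xs ys x
  | r + 1 => fun x => boostedNW K h xs ys r x +
      nadarayaWatson K h xs (fun i => ys i - boostedNW K h xs ys r (xs i)) x

/-- The first `n` members of a sequence of real random variables, as a random vector. -/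
def firstN {Ω : Type*} (Z : ℕ → Ω → ℝ) (n : ℕ) (ω : Ω) : Fin n → ℝ := fun i => Z i ω

/-- The conditional expectation `E[φ(U, V) | U]` of a function of two random vectors, computed
by integrating against the regular conditional distribution of `V` given `U`. -/
noncomputable def condMeanGiven {Ω : Type*} [MeasurableSpace Ω] (μ : Measure Ω)
    [IsFiniteMeasure μ] {n : ℕ} (U V : Ω → Fin n → ℝ)
    (φ : (Fin n → ℝ) → (Fin n → ℝ) → ℝ) (ω : Ω) : ℝ :=
  ∫ v, φ (U ω) v ∂(condDistrib V U μ (U ω))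

/-- `condMeanGiven` is a version of the conditional expectation given the `σ`-algebra of `U`.
(It is used in place of `μ[· | ·]` so that for a family `φ x`, `x ∈ ℝ`, one version is fixed
simultaneously for all `x`, and suprema over `x` make sense.) -/
theorem condMeanGiven_ae_eq_condExp {Ω : Type*} [MeasurableSpace Ω] (μ : Measure Ω)
    [IsFiniteMeasure μ] {n : ℕ} (U V : Ω → Fin n → ℝ) (hU : Measurable U) (hV : Measurable V)
    (φ : (Fin n → ℝ) → (Fin n → ℝ) → ℝ) (hφ : Measurable (Function.uncurry φ))
    (hint : Integrable (fun ω => φ (U ω) (V ω)) μ) :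
    condMeanGiven μ U V φ =ᵐ[μ]
      μ[fun ω => φ (U ω) (V ω) | MeasurableSpace.comap U inferInstance] :=
  (condExp_prod_ae_eq_integral_condDistrib hU hV.aemeasurable hφ.stronglyMeasurable hint).symm

/-- `Z n x = O_p(a n)` uniformly for `x ∈ S`, as `n → ∞`: for every `η > 0` there is `M` such
that, for all large `n`, the event `sup_{x ∈ S} |Z n x| > M * a n` has probability at most `η`. -/
def IsBigOpUniformly {Ω : Type*} [MeasurableSpace Ω] (μ : Measure Ω) (S : Set ℝ)
    (Z : ℕ → ℝ → Ω → ℝ) (a : ℕ → ℝ) : Prop :=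
  ∀ η : ℝ, 0 < η → ∃ M : ℝ, ∀ᶠ n in atTop,
    μ {ω | ∃ x ∈ S, M * a n < |Z n x ω|} ≤ ENNReal.ofReal η

/-- The conditional bias `E[m̂_r(x) | X_1, …, X_n] - m(x)` of the `r`-step boosted estimate. -/
noncomputable def condBias {Ω : Type*} [MeasurableSpace Ω] (μ : Measure Ω) [IsFiniteMeasure μ]
    (X Y : ℕ → Ω → ℝ) (m K : ℝ → ℝ) (h : ℕ → ℝ) (r n : ℕ) (x : ℝ) (ω : Ω) : ℝ :=
  condMeanGiven μ (firstN X n) (firstN Y n) (fun xs ys => boostedNW K (h n) xs ys r x) ω - m x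

/-- The conditional mean squared error `E[(m̂_r(x) - m(x))² | X_1, …, X_n]` of the `r`-step
boosted estimate. -/
noncomputable def condMSE {Ω : Type*} [MeasurableSpace Ω] (μ : Measure Ω) [IsFiniteMeasure μ]
    (X Y : ℕ → Ω → ℝ) (m K : ℝ → ℝ) (h : ℕ → ℝ) (r n : ℕ) (x : ℝ) (ω : Ω) : ℝ :=
  condMeanGiven μ (firstN X n) (firstN Y n)
    (fun xs ys => (boostedNW K (h n) xs ys r x - m x) ^ 2) ω

/-!
Write `S` for the smoother at the population level, `S g (x) = E[K_h(X - x) g(X)] / E[K_h(X - x)]`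
(`localAvg`), and `Ŝ` for the Nadaraya-Watson smoother itself. Boosting is linear in the responses,
and on noiseless responses `g(X_i)` it returns `g - (1 - Ŝ)^(r + 1) g` (`boostedNW_eq_sub_iterate`).
Given the covariates the responses have means `m(X_i)`, so the conditional bias is
`-(1 - Ŝ)^(r + 1) m`. It is compared with `(1 - S)^(r + 1) m`.

*Population residuals.* Around a point `x`, expand the density and the current residual into
polynomials in the distance from `x`, with errors `O(h^(ν - 1))` and `O(h^ν)`. Because `K` is
symmetric, smoothing a polynomial changes it by `h^2` times a polynomial, and so `1 - S` multiplies
the polynomial part by `h^2` and keeps an error `O(h^ν)` (`exists_residual_approx`); the error of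
the density may be one order larger because it is multiplied by an increment of the residual.
After `r + 1 ≥ ν / 2` steps everything is `O(h^ν)` (`exists_abs_iterate_popResidual_le_rpow`).
Uniformity in `x` and `h` is kept by working with polynomials whose coefficients are bounded
functions of the pair `(x, h)` (`boundedFamilies`).

*Empirical against population smoother.* Telescoping bounds the difference of the two iterated
residuals by the differences `(Ŝ - S) g_j`, `g_j = (1 - S)^j m`, on a slightly larger interval
(`abs_iterate_empResidual_sub_le`). The numerator of `(Ŝ - S) g_j (x)` is an average of the
centred variables `K_h(X_i - x) (g_j(X_i) - S g_j (x))`. They are bounded and have variance `O(h)`,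
since `g_j` oscillates by `O(h)` at distance `h`. Bernstein's inequality on a fine grid gives
`O(√(h log n / n))` uniformly (`exists_tendsto_measure_sup_average`, `exists_good_event`).

*Mean squared error.* The boosted smoother has weights which are `O(1 / (n h))` and absolutely
summable with a bounded sum, so that their squares add up to `O(1 / (n h))`
(`sum_sq_boostWeight_le`). Given the covariates the errors `Y_i - m(X_i)` are uncorrelated with
bounded variances (`ae_integral_mul_response_sub`), which gives the variance. The stochastic part
`h log n / n` of the squared bias is dominated by `1 / (n h) + h^(2 ν)`
(`IsBandwidth.eventually_mul_log_div_le`).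
-/

/-! ### Smoothing kernels -/

namespace IsSmoothingKernel

variable {K : ℝ → ℝ}

lemma measurable (hK : IsSmoothingKernel K) : Measurable K := by
  obtain ⟨L, hL⟩ := hK.lipschitz
  exact hL.continuous.measurable

lemma abs_le_one_of_ne_zero (hK : IsSmoothingKernel K) {u : ℝ} (hu : K u ≠ 0) : |u| ≤ 1 := by
  by_contra h
  exact hu (hK.support u fun hmem => h (abs_le.2 hmem))

/-- A single constant serves as an upper bound and as a Lipschitz constant. -/
lemma exists_bound (hK : IsSmoothingKernel K) :
    ∃ κ > 0, (∀ u, K u ≤ κ) ∧ ∀ u v, |K u - K v| ≤ κ * |u - v| := by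
  obtain ⟨L, hL⟩ := hK.lipschitz
  have hlip : ∀ u v, |K u - K v| ≤ (L : ℝ) * |u - v| := fun u v => by
    simpa [Real.dist_eq] using hL.dist_le_mul u v
  refine ⟨3 * L + 1, by positivity, fun u => ?_, fun u v => (hlip u v).trans ?_⟩
  · by_cases hu : K u = 0
    · rw [hu]; positivity
    · have h1 := abs_le.1 (hK.abs_le_one_of_ne_zero hu)
      have h2 := hlip u 2
      rw [hK.support 2 (by norm_num), sub_zero] at h2
      have h3 : |u - 2| ≤ 3 := abs_le.2 ⟨by linarith, by linarith⟩
      have h4 := mul_le_mul_of_nonneg_left h3 L.coe_nonneg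
      linarith [le_abs_self (K u)]
  · gcongr
    linarith [L.coe_nonneg]

lemma integrable (hK : IsSmoothingKernel K) : Integrable K := by
  by_contra h
  have := hK.integral_eq_one
  rw [integral_undef h] at this
  norm_num at this

lemma integrable_mul (hK : IsSmoothingKernel K) {φ : ℝ → ℝ} (hφ : Measurable φ) {B : ℝ}
    (hB : ∀ t, |t| ≤ 1 → |φ t| ≤ B) : Integrable fun t => K t * φ t := by
  refine (hK.integrable.mul_const B).mono' (hK.measurable.mul hφ).aestronglyMeasurable
    (Eventually.of_forall fun t => ?_)
  rw [norm_mul, Real.norm_eq_abs, Real.norm_eq_abs, abs_of_nonneg (hK.nonneg t)]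
  by_cases ht : K t = 0
  · simp [ht]
  · exact mul_le_mul_of_nonneg_left (hB t (hK.abs_le_one_of_ne_zero ht)) (hK.nonneg t)

lemma abs_integral_mul_le (hK : IsSmoothingKernel K) {φ : ℝ → ℝ} {B : ℝ}
    (hB : ∀ t, |t| ≤ 1 → |φ t| ≤ B) : |∫ t, K t * φ t| ≤ B := by
  have h := norm_integral_le_of_norm_le (f := fun t => K t * φ t) (hK.integrable.mul_const B)
    (Eventually.of_forall fun t => ?_)
  · rwa [integral_mul_const, hK.integral_eq_one, one_mul] at h
  · rw [norm_mul, Real.norm_eq_abs, Real.norm_eq_abs, abs_of_nonneg (hK.nonneg t)]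
    by_cases ht : K t = 0
    · simp [ht]
    · exact mul_le_mul_of_nonneg_left (hB t (hK.abs_le_one_of_ne_zero ht)) (hK.nonneg t)

lemma le_integral_mul (hK : IsSmoothingKernel K) {φ : ℝ → ℝ} (hφ : Measurable φ) {B c : ℝ}
    (hB : ∀ t, |t| ≤ 1 → |φ t| ≤ B) (hc : ∀ t, |t| ≤ 1 → c ≤ φ t) : c ≤ ∫ t, K t * φ t := by
  have h : ∫ t, K t * c ≤ ∫ t, K t * φ t := by
    refine integral_mono (hK.integrable.mul_const c) (hK.integrable_mul hφ hB) fun t => ?_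
    by_cases ht : K t = 0
    · simp [ht]
    · exact mul_le_mul_of_nonneg_left (hc t (hK.abs_le_one_of_ne_zero ht)) (hK.nonneg t)
  rwa [integral_mul_const, hK.integral_eq_one, one_mul] at h

/-- The first moment of a smoothing kernel vanishes by symmetry. -/
lemma integral_mul_id (hK : IsSmoothingKernel K) : ∫ t, K t * t = 0 := by
  have h := integral_neg_eq_self (fun t => K t * t) volume
  simp only [hK.symm, mul_neg, integral_neg] at h
  linarith

end IsSmoothingKernel

/-! ### Taylor's formula with a Hölder remainder -/

/-- Taylor's formula on `[0, 1]` with a Hölder remainder: the top derivative is compared with its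
value at the centre. -/
lemma abs_sub_taylorWithinEval_le {α C : ℝ} (hα : 0 ≤ α) (hC : 0 ≤ C) {x₀ : ℝ}
    (hx₀ : x₀ ∈ Icc (0 : ℝ) 1) (n : ℕ) : ∀ g : ℝ → ℝ, ContDiffOn ℝ n g (Icc 0 1) →
    (∀ x ∈ Icc (0 : ℝ) 1, |iteratedDerivWithin n g (Icc 0 1) x -
      iteratedDerivWithin n g (Icc 0 1) x₀| ≤ C * |x - x₀| ^ α) →
    ∀ x ∈ Icc (0 : ℝ) 1,
      |g x - taylorWithinEval g n (Icc 0 1) x₀ x| ≤ C * |x - x₀| ^ (α + n) := by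
  have hU : UniqueDiffOn ℝ (Icc (0 : ℝ) 1) := uniqueDiffOn_Icc zero_lt_one
  induction n with
  | zero =>
    intro g _ hg x hx
    simpa using hg x hx
  | succ n ih =>
    intro g hcd hg x hx
    have hcd' : ContDiffOn ℝ n (derivWithin g (Icc 0 1)) (Icc 0 1) :=
      hcd.derivWithin hU (by norm_cast)
    have key := ih (derivWithin g (Icc 0 1)) hcd' (fun z hz => by
      simpa only [iteratedDerivWithin_succ'] using hg z hz)
    have hsub : uIcc x₀ x ⊆ Icc 0 1 := OrdConnected.uIcc_subset ordConnected_Icc hx₀ hx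
    have hder : ∀ z ∈ uIcc x₀ x, HasDerivWithinAt
        (fun z => g z - taylorWithinEval g (n + 1) (Icc 0 1) x₀ z)
        (derivWithin g (Icc 0 1) z -
          taylorWithinEval (derivWithin g (Icc 0 1)) n (Icc 0 1) x₀ z) (uIcc x₀ x) z := by
      intro z hz
      refine HasDerivWithinAt.sub ?_ (hasDerivAt_taylorWithinEval_succ g n).hasDerivWithinAt
      have hd : DifferentiableWithinAt ℝ g (Icc 0 1) z :=
        (hcd.differentiableOn (by simp)) z (hsub hz)
      exact hd.hasDerivWithinAt.mono hsub
    have hmv := Convex.norm_image_sub_le_of_norm_hasDerivWithin_le hder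
      (C := C * |x - x₀| ^ (α + n)) (fun z hz => ?_) (convex_uIcc _ _) left_mem_uIcc right_mem_uIcc
    · simp only [taylorWithinEval_self, sub_self, sub_zero, Real.norm_eq_abs] at hmv
      refine hmv.trans (le_of_eq ?_)
      rw [mul_assoc]
      congr 1
      push_cast
      rw [← add_assoc, Real.rpow_add_one' (abs_nonneg _) (by positivity)]
    · rw [Real.norm_eq_abs]
      refine (key z (hsub hz)).trans ?_
      gcongr 2
      exact abs_sub_left_of_mem_uIcc hz

/-! ### Polynomial families with bounded coefficients -/

/-- The ring of bounded real families. Polynomials with coefficients in this ring are families of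
real polynomials of bounded degree with uniformly bounded coefficients. -/
def boundedFamilies (ι : Type*) : Subring (ι → ℝ) where
  carrier := {c | ∃ B, ∀ i, |c i| ≤ B}
  zero_mem' := ⟨0, fun i => by simp⟩
  one_mem' := ⟨1, fun i => by simp⟩
  add_mem' := by
    rintro a b ⟨A, hA⟩ ⟨B, hB⟩
    exact ⟨A + B, fun i => (abs_add_le _ _).trans (add_le_add (hA i) (hB i))⟩
  mul_mem' := by
    rintro a b ⟨A, hA⟩ ⟨B, hB⟩
    refine ⟨A * B, fun i => ?_⟩
    rw [Pi.mul_apply, abs_mul]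
    exact mul_le_mul (hA i) (hB i) (abs_nonneg _) ((abs_nonneg _).trans (hA i))
  neg_mem' := by
    rintro a ⟨A, hA⟩
    exact ⟨A, fun i => by simpa using hA i⟩

namespace boundedFamilies

variable {ι : Type*}

open Polynomial

/-- Evaluation at the point `y` of the member with index `i` of a bounded polynomial family. -/
noncomputable def ev (i : ι) (y : ℝ) : (boundedFamilies ι)[X] →+* ℝ :=
  eval₂RingHom ((Pi.evalRingHom (fun _ : ι => ℝ) i).comp (boundedFamilies ι).subtype) y

@[simp] lemma ev_C (i : ι) (y : ℝ) (c : boundedFamilies ι) : ev i y (C c) = (c : ι → ℝ) i := by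
  simp [ev]

@[simp] lemma ev_X (i : ι) (y : ℝ) : ev i y (X : (boundedFamilies ι)[X]) = y := by
  simp [ev]

lemma ev_bounded (p : (boundedFamilies ι)[X]) (A : ℝ) :
    ∃ B, 0 ≤ B ∧ ∀ i y, |y| ≤ A → |ev i y p| ≤ B := by
  suffices h : ∃ B, ∀ i y, |y| ≤ A → |ev i y p| ≤ B by
    obtain ⟨B, hB⟩ := h
    exact ⟨max B 0, le_max_right _ _, fun i y hy => (hB i y hy).trans (le_max_left _ _)⟩
  induction p using Polynomial.induction_on' with
  | add p q hp hq =>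
    obtain ⟨B, hB⟩ := hp
    obtain ⟨B', hB'⟩ := hq
    refine ⟨B + B', fun i y hy => ?_⟩
    rw [map_add]
    exact (abs_add_le _ _).trans (add_le_add (hB i y hy) (hB' i y hy))
  | monomial n c =>
    obtain ⟨B, hB⟩ := c.2
    refine ⟨B * A ^ n, fun i y hy => ?_⟩
    rw [← C_mul_X_pow_eq_monomial, map_mul, map_pow, ev_C, ev_X, abs_mul, abs_pow]
    have := (abs_nonneg _).trans (hB i)
    gcongr
    exact hB i

lemma ev_lipschitz (p : (boundedFamilies ι)[X]) (A : ℝ) :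
    ∃ B, 0 ≤ B ∧ ∀ i y z, |y| ≤ A → |z| ≤ A → |ev i y p - ev i z p| ≤ B * |y - z| := by
  induction p using Polynomial.induction_on with
  | C a => exact ⟨0, le_rfl, fun i y z _ _ => by simp⟩
  | add p q hp hq =>
    obtain ⟨B, h0, hB⟩ := hp
    obtain ⟨B', h0', hB'⟩ := hq
    refine ⟨B + B', by positivity, fun i y z hy hz => ?_⟩
    rw [map_add, map_add, add_sub_add_comm, add_mul]
    exact (abs_add_le _ _).trans (add_le_add (hB i y z hy hz) (hB' i y z hy hz))
  | monomial n a ih =>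
    obtain ⟨B, h0, hB⟩ := ih
    obtain ⟨B', h0', hB'⟩ := ev_bounded (C a * X ^ n) A
    refine ⟨B' + B * |A|, by positivity, fun i y z hy hz => ?_⟩
    rw [pow_succ, ← mul_assoc, map_mul, map_mul _ _ X, ev_X, ev_X]
    have h1 := hB i y z hy hz
    have h2 := hB' i y hy
    have : ev i y (C a * X ^ n) * y - ev i z (C a * X ^ n) * z =
      ev i y (C a * X ^ n) * (y - z) + (ev i y (C a * X ^ n) - ev i z (C a * X ^ n)) * z := by ring
    rw [this]
    refine (abs_add_le _ _).trans ?_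
    rw [abs_mul, abs_mul, add_mul]
    refine add_le_add (by gcongr) ?_
    calc _ ≤ (B * |y - z|) * |A| :=
          mul_le_mul h1 (hz.trans (le_abs_self A)) (abs_nonneg _) (by positivity)
      _ = _ := by ring

lemma continuous_ev (p : (boundedFamilies ι)[X]) (i : ι) : Continuous fun y => ev i y p := by
  induction p using Polynomial.induction_on' with
  | add p q hp hq =>
    simp only [map_add]
    exact hp.add hq
  | monomial n c =>
    simp only [← C_mul_X_pow_eq_monomial, map_mul, map_pow, ev_C, ev_X]
    fun_prop

/-- Smoothing a polynomial family with a symmetric kernel at bandwidth `h` changes it by `h ^ 2`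
times another polynomial family: the first order terms cancel by symmetry. -/
lemma exists_smoothing_eq {K : ℝ → ℝ} (hK : IsSmoothingKernel K) (h : boundedFamilies ι)
    (p : (boundedFamilies ι)[X]) : ∃ N : (boundedFamilies ι)[X], ∀ i y,
      ∫ t, K t * (ev i (y + (h : ι → ℝ) i * t) p - ev i y p) =
        (h : ι → ℝ) i ^ 2 * ev i y N := by
  have hint : ∀ (p : (boundedFamilies ι)[X]) i y,
      Integrable fun t => K t * (ev i (y + (h : ι → ℝ) i * t) p - ev i y p) := by
    intro p i y
    obtain ⟨B, h0, hB⟩ := ev_bounded p (|y| + |(h : ι → ℝ) i|)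
    refine hK.integrable_mul (B := B + B)
      (((continuous_ev p i).comp (by fun_prop)).measurable.sub measurable_const) fun t ht => ?_
    refine (abs_sub _ _).trans (add_le_add (hB _ _ ?_) (hB _ _ (by simp)))
    refine (abs_add_le _ _).trans (add_le_add le_rfl ?_)
    rw [abs_mul]
    exact mul_le_of_le_one_right (abs_nonneg _) ht
  induction p using Polynomial.induction_on' with
  | add p q hp hq =>
    obtain ⟨N, hN⟩ := hp
    obtain ⟨N', hN'⟩ := hq
    refine ⟨N + N', fun i y => ?_⟩
    simp only [map_add, mul_add, ← hN, ← hN']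
    rw [← integral_add (hint p i y) (hint q i y)]
    congr 1 with t
    ring
  | monomial n c =>
    -- Expand `(y + h t) ^ n` by the binomial formula. The term `k = 0` cancels in the difference
    -- and the term `k = 1` vanishes by symmetry, which leaves a factor `h ^ 2`.
    let κ : ℕ → boundedFamilies ι := fun k =>
      ⟨fun _ => if k < 2 then 0 else (∫ t, K t * t ^ k) * n.choose k, _, fun _ => le_rfl⟩
    refine ⟨C c * ∑ k ∈ Finset.range (n + 1), C (κ k * h ^ (k - 2)) * X ^ (n - k), fun i y => ?_⟩
    have hmom : ∀ k : ℕ, Integrable fun t => K t * t ^ k := fun k =>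
      hK.integrable_mul (B := 1) (by fun_prop) fun t ht => by
        rw [abs_pow]; exact pow_le_one₀ (abs_nonneg _) ht
    set H := (h : ι → ℝ) i with hH
    set c' := (c : ι → ℝ) i with hc'
    have hexp : ∀ t, K t * (ev i (y + H * t) (monomial n c) - ev i y (monomial n c)) =
        ∑ k ∈ Finset.range (n + 1), (if k = 0 then 0 else
          c' * y ^ (n - k) * H ^ k * n.choose k) * (K t * t ^ k) := by
      intro t
      simp only [← C_mul_X_pow_eq_monomial, map_mul, map_pow, ev_C, ev_X]
      rw [add_comm y, add_pow, Finset.sum_range_succ', Finset.sum_range_succ']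
      simp only [Nat.succ_ne_zero, if_false, if_true]
      simp only [pow_zero, one_mul, Nat.sub_zero, Nat.choose_zero_right, Nat.cast_one, mul_one,
        zero_mul, add_zero, mul_add, add_sub_cancel_right, Finset.mul_sum]
      refine Finset.sum_congr rfl fun k _ => ?_
      rw [mul_pow]; ring
    simp only [hexp]
    rw [integral_finsetSum _ fun k _ => (hmom k).const_mul _]
    simp only [integral_const_mul, map_mul, map_sum, ev_C, map_pow, ev_X, Finset.mul_sum]
    refine Finset.sum_congr rfl fun k _ => ?_
    simp only [κ, ← hH, ← hc']
    rcases k with _ | _ | k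
    · simp
    · simp [hK.integral_mul_id]
    · simp
      ring

end boundedFamilies

/-! ### One step of the population smoother -/

/-- The population version of the Nadaraya-Watson smoother for the design density `f`, in the
variable `t = (u - x) / h` of integration. -/
noncomputable def localAvg (K : ℝ → ℝ) (h : ℝ) (f g : ℝ → ℝ) (x : ℝ) : ℝ :=
  (∫ t, K t * (f (x + h * t) * g (x + h * t))) / ∫ t, K t * f (x + h * t)

section Expansion

open boundedFamilies Polynomial

variable {ι : Type*} {K : ℝ → ℝ} {h : boundedFamilies ι}

local notation "hv" => (h : ι → ℝ)

lemma abs_add_mul_le {k y η t : ℝ} (hη : 0 ≤ η) (hy : |y| ≤ k * η) (ht : |t| ≤ 1) :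
    |y + η * t| ≤ (k + 1) * η := by
  refine (abs_add_le _ _).trans ?_
  rw [abs_mul, abs_of_nonneg hη]
  nlinarith

/-- The reciprocal of the smoothed density agrees with a polynomial family up to the order to which
the density itself does: a truncated geometric series inverts the polynomial approximation. -/
lemma exists_inv_approx (hK : IsSmoothingKernel K) (hpos : ∀ i, 0 < hv i) (hle : ∀ i, hv i ≤ 1)
    {β c B A k : ℝ} (hβ : 1 ≤ β) (hc : 0 < c) (hk : 0 ≤ k)
    {F : ι → ℝ → ℝ} (hFm : ∀ i, Measurable (F i))
    (hFlow : ∀ i y, |y| ≤ (k + 1) * hv i → c ≤ F i y)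
    (hFup : ∀ i y, |F i y| ≤ A)
    {q : (boundedFamilies ι)[X]}
    (hq : ∀ i y, |y| ≤ (k + 1) * hv i → |F i y - ev i y q| ≤ B * hv i ^ β) :
    ∃ e : (boundedFamilies ι)[X], ∃ B', 0 ≤ B' ∧ ∀ i y, |y| ≤ k * hv i →
      |(∫ t, K t * F i (y + hv i * t))⁻¹ - ev i y e| ≤ B' * hv i ^ β := by
  obtain ⟨N, hN⟩ := exists_smoothing_eq hK h q
  let q₀ : boundedFamilies ι := ⟨fun i => (F i 0)⁻¹, c⁻¹, fun i => by
    have h0 : c ≤ F i 0 := hFlow i 0 (by rw [abs_zero]; have := hpos i; positivity)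
    rw [abs_inv, abs_of_pos (hc.trans_le h0)]
    exact inv_anti₀ hc h0⟩
  let d := q + C h ^ 2 * N
  -- `e` inverts `d` up to the `n`-th power of the relative deviation, and `n ≥ β`
  set n := ⌈β⌉₊ with hn
  let e := C q₀ * ∑ j ∈ Finset.range n, (1 - C q₀ * d) ^ j
  obtain ⟨Le, hLe0, hLe⟩ := ev_bounded e k
  obtain ⟨Lq, hLq0, hLq⟩ := ev_lipschitz q (k + 1)
  obtain ⟨Bq, hBq0, hBq⟩ := ev_bounded q (k + 1)
  -- the relative deviation of `d` from its value at the centre is at most `R * h`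
  set R := c⁻¹ * (Lq * (k + 1) + 3 * |B|) with hR
  have hR0 : 0 ≤ R := by positivity
  refine ⟨e, c⁻¹ * (R ^ n + |B| * Le), by positivity, fun i y hy => ?_⟩
  set η := hv i with hη
  have hη0 : 0 < η := hpos i
  have hη1 : η ≤ 1 := hle i
  have hηβ : 0 < η ^ β := Real.rpow_pos_of_pos hη0 _
  have hηβ1 : η ^ β ≤ η := by
    simpa using Real.rpow_le_rpow_of_exponent_ge hη0 hη1 hβ
  have hq' : ∀ y, |y| ≤ (k + 1) * η → |F i y - ev i y q| ≤ |B| * η ^ β := fun y hy =>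
    (hq i y hy).trans (by gcongr; exact le_abs_self B)
  have hkη : k * η ≤ k := mul_le_of_le_one_right hk hη1
  have hkη' : (k + 1) * η ≤ k + 1 := mul_le_of_le_one_right (by positivity) hη1
  have hs : ∀ t : ℝ, |t| ≤ 1 → |y + η * t| ≤ (k + 1) * η := fun t ht =>
    abs_add_mul_le hη0.le hy ht
  set D := ∫ t, K t * F i (y + η * t) with hD
  have hDlow : c ≤ D := hK.le_integral_mul ((hFm i).comp (by fun_prop)) (B := A)
    (fun t _ => hFup i _) (fun t ht => hFlow i _ (hs t ht))
  have hD0 : 0 < D := hc.trans_le hDlow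
  have hFms : Measurable fun t => F i (y + η * t) := (hFm i).comp (by fun_prop)
  have hqm : Measurable fun t => ev i (y + η * t) q :=
    ((continuous_ev q i).comp (by fun_prop)).measurable
  have hd : ev i y d = ∫ t, K t * ev i (y + η * t) q := by
    have h1 := hN i y
    simp only [mul_sub] at h1
    rw [integral_sub (hK.integrable_mul hqm (B := Bq) fun t ht => hBq i _ ((hs t ht).trans hkη'))
      (hK.integrable.mul_const _), integral_mul_const, hK.integral_eq_one, one_mul] at h1
    simp only [d, map_add, map_mul, map_pow, ev_C, ← h1]
    ring
  have hDd : |D - ev i y d| ≤ |B| * η ^ β := by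
    rw [hd, hD, ← integral_sub
      (hK.integrable_mul hFms (B := A) fun t _ => hFup i _)
      (hK.integrable_mul hqm (B := Bq) fun t ht => hBq i _ ((hs t ht).trans hkη'))]
    simp only [← mul_sub]
    exact hK.abs_integral_mul_le fun t ht => hq' _ (hs t ht)
  have h00 : |(0 : ℝ)| ≤ (k + 1) * η := by rw [abs_zero]; positivity
  have hF0 : c ≤ F i 0 := hFlow i 0 h00
  have hF0' : 0 < F i 0 := hc.trans_le hF0
  have hDF : |D - F i 0| ≤ (Lq * (k + 1) + 2 * |B|) * η := by
    have h1 : D - F i 0 = ∫ t, K t * (F i (y + η * t) - F i 0) := by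
      simp only [mul_sub]
      rw [integral_sub
        (hK.integrable_mul hFms (B := A) fun t _ => hFup i _)
        (hK.integrable.mul_const _), integral_mul_const, hK.integral_eq_one, one_mul]
    rw [h1]
    refine hK.abs_integral_mul_le fun t ht => ?_
    have h2 := hq' _ (hs t ht)
    have h3 := hq' _ h00
    have h4 := hLq i (y + η * t) 0 ((hs t ht).trans hkη') (h00.trans hkη')
    rw [sub_zero] at h4
    have h5 := mul_le_mul_of_nonneg_left (hs t ht) hLq0
    have h6 := mul_le_mul_of_nonneg_left hηβ1 (abs_nonneg B)
    rw [abs_le] at h2 h3 h4 ⊢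
    constructor <;> linarith
  have hrel : |1 - ev i y (C q₀ * d)| ≤ R * η := by
    have h1 : 1 - ev i y (C q₀ * d) = (F i 0)⁻¹ * (F i 0 - ev i y d) := by
      rw [map_mul, ev_C, mul_sub, inv_mul_cancel₀ hF0'.ne']
    rw [h1, abs_mul, abs_of_pos (inv_pos.2 hF0'), hR, mul_assoc]
    have h6 := mul_le_mul_of_nonneg_left hηβ1 (abs_nonneg B)
    refine mul_le_mul (inv_anti₀ hc hF0) ?_ (abs_nonneg _) (by positivity)
    rw [abs_le] at hDF hDd ⊢
    constructor <;> linarith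
  have hde : 1 - ev i y d * ev i y e = (1 - ev i y (C q₀ * d)) ^ n := by
    have h1 := mul_neg_geom_sum (1 - C q₀ * d) n
    have h2 := congrArg (ev i y) h1
    simp only [map_sub, map_mul, map_pow, map_one, map_sum, e] at h2 ⊢
    linear_combination -h2
  have hDe : |1 - D * ev i y e| ≤ (R ^ n + |B| * Le) * η ^ β := by
    have h1 : 1 - D * ev i y e = (1 - ev i y (C q₀ * d)) ^ n - (D - ev i y d) * ev i y e := by
      rw [← hde]; ring
    have h2 : |(1 - ev i y (C q₀ * d)) ^ n| ≤ R ^ n * η ^ β := by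
      rw [abs_pow]
      refine (pow_le_pow_left₀ (abs_nonneg _) hrel n).trans ?_
      rw [mul_pow, ← Real.rpow_natCast η]
      gcongr 1
      exact Real.rpow_le_rpow_of_exponent_ge hη0 hη1 (Nat.le_ceil β)
    have h3 : |(D - ev i y d) * ev i y e| ≤ |B| * η ^ β * Le := by
      rw [abs_mul]
      exact mul_le_mul hDd (hLe i y (hy.trans hkη)) (abs_nonneg _) (by positivity)
    rw [h1]
    refine (abs_sub _ _).trans ((add_le_add h2 h3).trans (le_of_eq (by ring)))
  have h1 : D⁻¹ - ev i y e = D⁻¹ * (1 - D * ev i y e) := by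
    rw [mul_sub, mul_one, inv_mul_cancel_left₀ hD0.ne']
  rw [h1, abs_mul, abs_of_pos (inv_pos.2 hD0), mul_assoc]
  exact mul_le_mul (inv_anti₀ hc hDlow) hDe (abs_nonneg _) (by positivity)

/-- One application of `1 - S`, with `S` the population smoother, gains a factor `h ^ 2` on the
polynomial part of an expansion and keeps the order of the remainder. -/
lemma exists_residual_approx (hK : IsSmoothingKernel K) (hpos : ∀ i, 0 < hv i)
    (hle : ∀ i, hv i ≤ 1) {ν c B A k : ℝ} (hν : 2 ≤ ν) (hc : 0 < c) (hk : 0 ≤ k)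
    {F : ι → ℝ → ℝ} (hFm : ∀ i, Measurable (F i))
    (hFlow : ∀ i y, |y| ≤ (k + 1) * hv i → c ≤ F i y)
    (hFup : ∀ i y, |F i y| ≤ A)
    {q : (boundedFamilies ι)[X]}
    (hq : ∀ i y, |y| ≤ (k + 1) * hv i → |F i y - ev i y q| ≤ B * hv i ^ (ν - 1))
    {j : ℕ} {G : ι → ℝ → ℝ} (hGm : ∀ i, Measurable (G i)) {M : ℝ}
    (hG : ∀ i y, |G i y| ≤ M)
    {p : (boundedFamilies ι)[X]} {B₁ : ℝ}
    (hp : ∀ i y, |y| ≤ (k + 1) * hv i → |G i y - hv i ^ j * ev i y p| ≤ B₁ * hv i ^ ν) :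
    ∃ p' : (boundedFamilies ι)[X], ∃ B', ∀ i y, |y| ≤ k * hv i →
      |G i y - localAvg K (hv i) (F i) (G i) y - hv i ^ (j + 2) * ev i y p'| ≤
        B' * hv i ^ ν := by
  obtain ⟨e, Be, hBe0, hBe⟩ := exists_inv_approx hK hpos hle (β := ν - 1) (by linarith) hc hk
    hFm hFlow hFup hq
  obtain ⟨N₁, hN₁⟩ := exists_smoothing_eq hK h (q * p)
  obtain ⟨N₂, hN₂⟩ := exists_smoothing_eq hK h q
  let N := N₁ - p * N₂
  obtain ⟨Bq, hBq0, hBq⟩ := ev_bounded q (k + 1)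
  obtain ⟨Bqp, hBqp0, hBqp⟩ := ev_bounded (q * p) (k + 1)
  obtain ⟨BN, hBN0, hBN⟩ := ev_bounded N (k + 1)
  obtain ⟨Lp, hLp0, hLp⟩ := ev_lipschitz p (k + 1)
  set E := |A| * (2 * |B₁|) + |B| * Lp with hE
  refine ⟨-(N * e), c⁻¹ * E + BN * Be, fun i y hy => ?_⟩
  set η := hv i with hη
  have hη0 : 0 < η := hpos i
  have hη1 : η ≤ 1 := hle i
  have hηβ : 0 < η ^ (ν - 1) := Real.rpow_pos_of_pos hη0 _
  have hην : 0 < η ^ ν := Real.rpow_pos_of_pos hη0 _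
  have hηmul : η ^ (ν - 1) * η = η ^ ν := by
    rw [← Real.rpow_add_one hη0.ne']; ring_nf
  have hηj : η ^ j ≤ 1 := pow_le_one₀ hη0.le hη1
  have hηj0 : 0 < η ^ j := pow_pos hη0 j
  have hkη' : (k + 1) * η ≤ k + 1 := mul_le_of_le_one_right (by positivity) hη1
  have hs : ∀ t : ℝ, |t| ≤ 1 → |y + η * t| ≤ (k + 1) * η := fun t ht =>
    abs_add_mul_le hη0.le hy ht
  have hy' : |y| ≤ (k + 1) * η := hy.trans (by gcongr; linarith)
  set D := ∫ t, K t * F i (y + η * t) with hD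
  have hDlow : c ≤ D := hK.le_integral_mul ((hFm i).comp (by fun_prop)) (B := A)
    (fun t _ => hFup i _) (fun t ht => hFlow i _ (hs t ht))
  have hD0 : 0 < D := hc.trans_le hDlow
  have hA : ∀ y, |F i y| ≤ |A| := fun y => (hFup i y).trans (le_abs_self A)
  have hFms : Measurable fun t => F i (y + η * t) := (hFm i).comp (by fun_prop)
  have hGms : Measurable fun t => G i (y + η * t) := (hGm i).comp (by fun_prop)
  have hevm : ∀ p : (boundedFamilies ι)[X], Measurable fun t => ev i (y + η * t) p := fun p =>
    ((continuous_ev p i).comp (by fun_prop)).measurable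
  have hM0 : 0 ≤ M := (abs_nonneg _).trans (hG i y)
  have hFG : ∀ t, |F i (y + η * t) * G i (y + η * t)| ≤ |A| * M := fun t => by
    rw [abs_mul]; exact mul_le_mul (hA _) (hG i _) (abs_nonneg _) (abs_nonneg _)
  -- Split the numerator of the residual into the polynomial part `r₃` and two remainders. In `r₂`
  -- the error `h ^ (ν - 1)` of the density meets the increment `P = O(h)` of the polynomial.
  let P : ℝ → ℝ := fun t => η ^ j * (ev i (y + η * t) p - ev i y p)
  have hPm : Measurable P := ((hevm p).sub_const _).const_mul _
  have hP : ∀ t, |t| ≤ 1 → |P t| ≤ Lp * η := fun t ht => by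
    have h1 := hLp i (y + η * t) y ((hs t ht).trans hkη') (hy'.trans hkη')
    have h2 : |y + η * t - y| ≤ η := by
      rw [add_sub_cancel_left, abs_mul, abs_of_pos hη0]
      exact mul_le_of_le_one_right hη0.le ht
    simp only [P]
    rw [abs_mul, abs_of_pos hηj0]
    calc _ ≤ 1 * (Lp * η) := mul_le_mul hηj (h1.trans (by gcongr)) (abs_nonneg _) zero_le_one
      _ = _ := one_mul _
  let r₁ : ℝ → ℝ := fun t => F i (y + η * t) * (G i (y + η * t) - G i y - P t)
  let r₂ : ℝ → ℝ := fun t => (F i (y + η * t) - ev i (y + η * t) q) * P t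
  let r₃ : ℝ → ℝ := fun t => ev i (y + η * t) q * P t
  have hr₁ : ∀ t, |t| ≤ 1 → |r₁ t| ≤ |A| * (2 * |B₁|) * η ^ ν := fun t ht => by
    have h1 := hp i _ (hs t ht)
    have h2 := hp i _ hy'
    have h3 : B₁ * η ^ ν ≤ |B₁| * η ^ ν := by gcongr; exact le_abs_self _
    simp only [r₁, P]
    rw [abs_mul, mul_assoc]
    refine mul_le_mul (hA _) ?_ (abs_nonneg _) (abs_nonneg _)
    rw [abs_le] at h1 h2 ⊢
    constructor <;> linarith
  have hr₂ : ∀ t, |t| ≤ 1 → |r₂ t| ≤ |B| * Lp * η ^ ν := fun t ht => by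
    have h1 : |F i (y + η * t) - ev i (y + η * t) q| ≤ |B| * η ^ (ν - 1) :=
      (hq i _ (hs t ht)).trans (by gcongr; exact le_abs_self B)
    simp only [r₂]
    rw [abs_mul]
    calc _ ≤ (|B| * η ^ (ν - 1)) * (Lp * η) :=
          mul_le_mul h1 (hP t ht) (abs_nonneg _) (by positivity)
      _ = |B| * Lp * (η ^ (ν - 1) * η) := by ring
      _ = _ := by rw [hηmul]
  have hr₃ : ∀ t, |t| ≤ 1 → |r₃ t| ≤ Bq * (Lp * η) := fun t ht => by
    simp only [r₃]
    rw [abs_mul]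
    exact mul_le_mul (hBq i _ ((hs t ht).trans hkη')) (hP t ht) (abs_nonneg _) hBq0
  have hir₁ : Integrable fun t => K t * r₁ t :=
    hK.integrable_mul (hFms.mul ((hGms.sub_const _).sub hPm)) hr₁
  have hir₂ : Integrable fun t => K t * r₂ t :=
    hK.integrable_mul ((hFms.sub (hevm q)).mul hPm) hr₂
  have hir₃ : Integrable fun t => K t * r₃ t := hK.integrable_mul ((hevm q).mul hPm) hr₃
  have hnum : (∫ t, K t * (F i (y + η * t) * G i (y + η * t))) - D * G i y =
      (∫ t, K t * r₁ t) + (∫ t, K t * r₂ t) + ∫ t, K t * r₃ t := by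
    rw [← integral_add hir₁ hir₂,
      ← integral_add (f := fun t => K t * r₁ t + K t * r₂ t) (hir₁.add hir₂) hir₃, hD,
      ← integral_mul_const,
      ← integral_sub (hK.integrable_mul (φ := fun t => F i (y + η * t) * G i (y + η * t))
        (hFms.mul hGms) (fun t _ => hFG t))
      ((hK.integrable_mul hFms (fun t _ => hA _)).mul_const _)]
    congr 1 with t
    simp only [r₁, r₂, r₃]
    ring
  have hpoly : ∫ t, K t * r₃ t = η ^ (j + 2) * ev i y N := by
    have h1 := hN₁ i y
    have h2 := hN₂ i y
    rw [← hη] at h1 h2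
    have i1 : Integrable fun t => K t * (ev i (y + η * t) (q * p) - ev i y (q * p)) :=
      hK.integrable_mul ((hevm _).sub_const _) (B := Bqp + Bqp) fun t ht =>
        (abs_sub _ _).trans (add_le_add (hBqp i _ ((hs t ht).trans hkη'))
          (hBqp i _ (hy'.trans hkη')))
    have i2 : Integrable fun t => K t * (ev i (y + η * t) q - ev i y q) :=
      hK.integrable_mul ((hevm _).sub_const _) (B := Bq + Bq) fun t ht =>
        (abs_sub _ _).trans (add_le_add (hBq i _ ((hs t ht).trans hkη'))
          (hBq i _ (hy'.trans hkη')))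
    have h3 : ∫ t, K t * r₃ t = η ^ j *
        ((∫ t, K t * (ev i (y + η * t) (q * p) - ev i y (q * p))) -
          ev i y p * ∫ t, K t * (ev i (y + η * t) q - ev i y q)) := by
      rw [← integral_const_mul, ← integral_sub i1 (i2.const_mul _), ← integral_const_mul]
      congr 1 with t
      simp only [r₃, P, map_mul]
      ring
    rw [h3, h1, h2]
    simp only [N, map_sub, map_mul]
    ring
  set Er := (∫ t, K t * r₁ t) + ∫ t, K t * r₂ t with hEr
  have hErle : |Er| ≤ E * η ^ ν := by
    refine (abs_add_le _ _).trans
      ((add_le_add (hK.abs_integral_mul_le hr₁) (hK.abs_integral_mul_le hr₂)).trans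
        (le_of_eq (by rw [hE]; ring)))
  rw [hpoly] at hnum
  have hfin : G i y - localAvg K η (F i) (G i) y - η ^ (j + 2) * ev i y (-(N * e)) =
      -(D⁻¹ * Er) - η ^ (j + 2) * ev i y N * (D⁻¹ - ev i y e) := by
    have h1 : localAvg K η (F i) (G i) y = (D * G i y + (Er + η ^ (j + 2) * ev i y N)) * D⁻¹ := by
      rw [localAvg, ← hnum, div_eq_mul_inv]; ring
    rw [h1, map_neg, map_mul]
    have h2 := mul_inv_cancel₀ hD0.ne'
    linear_combination -(G i y) * h2
  rw [hfin]
  refine (abs_sub _ _).trans ?_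
  rw [abs_neg, add_mul]
  refine add_le_add ?_ ?_
  · rw [abs_mul, abs_of_pos (inv_pos.2 hD0), mul_assoc]
    exact mul_le_mul (inv_anti₀ hc hDlow) hErle (abs_nonneg _) (by positivity)
  · rw [abs_mul, abs_mul, abs_of_pos (pow_pos hη0 _)]
    have h1 : η ^ (j + 2) ≤ η := by
      simpa using pow_le_pow_of_le_one hη0.le hη1 (show 1 ≤ j + 2 by omega)
    calc _ ≤ (η * BN) * (Be * η ^ (ν - 1)) := by
          gcongr
          · exact hBN i y (hy'.trans hkη')
          · exact hBe i y hy
      _ = BN * Be * (η ^ (ν - 1) * η) := by ring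
      _ = _ := by rw [hηmul]

end Expansion

/-! ### Iterated population residuals of Hölder functions -/

lemma strictFloor_lt {s : ℝ} (hs : 0 < s) : (strictFloor s : ℝ) < s := by
  have h1 : 1 ≤ ⌈s⌉₊ := Nat.one_le_ceil_iff.2 hs
  rw [strictFloor, Nat.cast_sub h1]
  have := Nat.ceil_lt_add_one hs.le
  push_cast
  linarith

/-- The condition on `r` says that `r + 1` steps of order two reach the order `ν`. -/
lemma le_two_mul_of_strictFloor_le {ν : ℝ} {r : ℕ} (hr : strictFloor (ν / 2) ≤ r) :
    ν ≤ 2 * (r + 1) := by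
  have h1 : ⌈ν / 2⌉₊ ≤ r + 1 := by
    rw [strictFloor] at hr
    omega
  have h2 := Nat.ceil_le.1 h1
  push_cast at h2
  linarith

/-- The Hölder class only sees the restriction of a function to `[0, 1]`. -/
lemma HolderClass.congr {s C : ℝ} {g g' : ℝ → ℝ} (hg : g ∈ HolderClass s C)
    (h : EqOn g' g (Icc 0 1)) : g' ∈ HolderClass s C := by
  refine ⟨hg.1.congr h, fun x hx x' hx' => ?_⟩
  rw [iteratedDerivWithin_congr h hx, iteratedDerivWithin_congr h hx']
  exact hg.2 x hx x' hx'

/-- The Taylor polynomials of a Hölder function at the points of a family form a bounded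
polynomial family. -/
lemma HolderClass.exists_taylor_family {ι : Type*} {s C : ℝ} (hs : 0 < s) {g : ℝ → ℝ}
    (hg : g ∈ HolderClass s C) (x₀ : ι → ℝ) (hx₀ : ∀ i, x₀ i ∈ Icc (0 : ℝ) 1) :
    ∃ q : Polynomial (boundedFamilies ι), ∀ i y, x₀ i + y ∈ Icc (0 : ℝ) 1 →
      |g (x₀ i + y) - boundedFamilies.ev i y q| ≤ |C| * |y| ^ s := by
  have hU : UniqueDiffOn ℝ (Icc (0 : ℝ) 1) := uniqueDiffOn_Icc zero_lt_one
  set n := strictFloor s with hn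
  have hbd : ∀ k, k ≤ n → ∃ B, ∀ x ∈ Icc (0 : ℝ) 1, |iteratedDerivWithin k g (Icc 0 1) x| ≤ B :=
    fun k hk => isCompact_Icc.exists_bound_of_continuousOn
      (hg.1.continuousOn_iteratedDerivWithin (by exact_mod_cast hk) hU)
  let c : ℕ → boundedFamilies ι := fun k =>
    ⟨fun i => if k ≤ n then (k.factorial : ℝ)⁻¹ * iteratedDerivWithin k g (Icc 0 1) (x₀ i) else 0,
      by
        by_cases hk : k ≤ n
        · obtain ⟨B, hB⟩ := hbd k hk
          refine ⟨(k.factorial : ℝ)⁻¹ * B, fun i => ?_⟩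
          beta_reduce
          rw [if_pos hk, abs_mul, abs_of_pos (by positivity)]
          gcongr
          exact hB _ (hx₀ i)
        · exact ⟨0, fun i => by simp [hk]⟩⟩
  refine ⟨∑ k ∈ Finset.range (n + 1), Polynomial.C (c k) * Polynomial.X ^ k, fun i y hy => ?_⟩
  have h1 := abs_sub_taylorWithinEval_le (α := s - n) (sub_nonneg.2 (strictFloor_lt hs).le)
    (abs_nonneg C) (hx₀ i) n g hg.1 (fun x hx => (hg.2 x hx _ (hx₀ i)).trans
      (mul_le_mul_of_nonneg_right (le_abs_self C) (Real.rpow_nonneg (abs_nonneg _) _))) _ hy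
  rw [taylor_within_apply, add_sub_cancel_left, sub_add_cancel] at h1
  convert h1 using 3
  simp only [map_sum, map_mul, map_pow, boundedFamilies.ev_C, boundedFamilies.ev_X, c]
  refine Finset.sum_congr rfl fun k hk => ?_
  rw [if_pos (Nat.lt_succ_iff.1 (Finset.mem_range.1 hk)), smul_eq_mul]
  ring

section LocalAvg

variable {K f g : ℝ → ℝ} {h A M : ℝ}

lemma measurable_localAvg (hK : IsSmoothingKernel K) (hf : Measurable f) (hg : Measurable g)
    (h : ℝ) : Measurable (localAvg K h f g) := by
  have h1 := hK.measurable
  refine Measurable.div ?_ ?_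
  · refine (StronglyMeasurable.integral_prod_right
      (f := fun x t => K t * (f (x + h * t) * g (x + h * t))) ?_).measurable
    exact Measurable.stronglyMeasurable (by simp only [Function.uncurry_def]; fun_prop)
  · refine (StronglyMeasurable.integral_prod_right (f := fun x t => K t * f (x + h * t))
      ?_).measurable
    exact Measurable.stronglyMeasurable (by simp only [Function.uncurry_def]; fun_prop)

/-- The population smoother is an average of the values within distance `h`. -/
lemma abs_localAvg_sub_le (hK : IsSmoothingKernel K) (hf : Measurable f) (hf0 : ∀ u, 0 ≤ f u)
    (hfA : ∀ u, f u ≤ A) (hg : Measurable g) (hM : ∀ u, |g u| ≤ M) {x a b : ℝ}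
    (hD : 0 < ∫ t, K t * f (x + h * t)) (hab : ∀ t, |t| ≤ 1 → |g (x + h * t) - a| ≤ b) :
    |localAvg K h f g x - a| ≤ b := by
  have hfm : Measurable fun t => f (x + h * t) := hf.comp (by fun_prop)
  have hgm : Measurable fun t => g (x + h * t) := hg.comp (by fun_prop)
  have hfA' : ∀ u, |f u| ≤ A := fun u => by rw [abs_of_nonneg (hf0 u)]; exact hfA u
  have i1 : Integrable fun t => K t * f (x + h * t) :=
    hK.integrable_mul hfm (fun t _ => hfA' _)
  have i2 : Integrable fun t => K t * (f (x + h * t) * g (x + h * t)) :=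
    hK.integrable_mul (hfm.mul hgm) (B := A * M) (fun t _ => by
      rw [abs_mul]
      exact mul_le_mul (hfA' _) (hM _) (abs_nonneg _) ((abs_nonneg _).trans (hfA' 0)))
  have h1 : localAvg K h f g x - a =
      (∫ t, K t * f (x + h * t) * (g (x + h * t) - a)) / ∫ t, K t * f (x + h * t) := by
    rw [localAvg, eq_div_iff hD.ne', sub_mul, div_mul_cancel₀ _ hD.ne', ← integral_const_mul,
      ← integral_sub i2 (i1.const_mul _)]
    congr 1 with t
    ring
  rw [h1, abs_div, abs_of_pos hD, div_le_iff₀ hD, ← integral_const_mul]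
  refine norm_integral_le_of_norm_le (f := fun t => K t * f (x + h * t) * (g (x + h * t) - a))
    (i1.const_mul b) (Eventually.of_forall fun t => ?_)
  rw [norm_mul, Real.norm_eq_abs, Real.norm_eq_abs,
    abs_of_nonneg (mul_nonneg (hK.nonneg t) (hf0 _)), mul_comm b]
  by_cases ht : K t = 0
  · simp [ht]
  · exact mul_le_mul_of_nonneg_left (hab t (hK.abs_le_one_of_ne_zero ht))
      (mul_nonneg (hK.nonneg t) (hf0 _))

lemma abs_localAvg_le (hK : IsSmoothingKernel K) (hf : Measurable f) (hf0 : ∀ u, 0 ≤ f u)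
    (hfA : ∀ u, f u ≤ A) (hg : Measurable g) (hM : ∀ u, |g u| ≤ M) (x : ℝ) :
    |localAvg K h f g x| ≤ M := by
  have h0 : 0 ≤ ∫ t, K t * f (x + h * t) :=
    integral_nonneg fun t => mul_nonneg (hK.nonneg t) (hf0 _)
  rcases h0.eq_or_lt with h1 | h1
  · rw [localAvg, ← h1, div_zero, abs_zero]
    exact (abs_nonneg _).trans (hM 0)
  · simpa using abs_localAvg_sub_le hK hf hf0 hfA hg hM (a := 0) h1 (fun t _ => by simpa using hM _)

/-- The residual of the population smoother, `g ↦ g - S g`. -/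
noncomputable def popResidual (K : ℝ → ℝ) (h : ℝ) (f g : ℝ → ℝ) (x : ℝ) : ℝ :=
  g x - localAvg K h f g x

lemma measurable_iterate_popResidual (hK : IsSmoothingKernel K) (hf : Measurable f)
    (hg : Measurable g) (h : ℝ) (k : ℕ) : Measurable ((popResidual K h f)^[k] g) := by
  induction k with
  | zero => exact hg
  | succ k ih =>
    rw [Function.iterate_succ_apply']
    exact ih.sub (measurable_localAvg hK hf ih h)

lemma abs_iterate_popResidual_le (hK : IsSmoothingKernel K) (hf : Measurable f)
    (hf0 : ∀ u, 0 ≤ f u) (hfA : ∀ u, f u ≤ A) (hg : Measurable g) (hM : ∀ u, |g u| ≤ M)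
    (h : ℝ) (k : ℕ) (x : ℝ) : |(popResidual K h f)^[k] g x| ≤ 2 ^ k * M := by
  induction k generalizing x with
  | zero => simpa using hM x
  | succ k ih =>
    rw [Function.iterate_succ_apply', popResidual]
    refine (abs_sub _ _).trans ?_
    have := abs_localAvg_le (h := h) hK hf hf0 hfA (measurable_iterate_popResidual hK hf hg h k)
      ih x
    rw [pow_succ]
    linarith [ih x]

lemma localAvg_shift (K : ℝ → ℝ) (h : ℝ) (f g : ℝ → ℝ) (x y : ℝ) :
    localAvg K h (fun z => f (x + z)) (fun z => g (x + z)) y = localAvg K h f g (x + y) := by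
  simp only [localAvg, add_assoc]

/-- The bias of boosting with the population smoother: after `k` steps of order two each, a
regression function of smoothness `ν ≤ 2 k` leaves a residual of order `h ^ ν`. -/
lemma exists_abs_iterate_popResidual_le_rpow (hK : IsSmoothingKernel K) (hf : Measurable f)
    (hf0 : ∀ u, 0 ≤ f u) (hfA : ∀ u, f u ≤ A) {c : ℝ} (hc : 0 < c)
    (hfc : ∀ u ∈ Icc (0 : ℝ) 1, c ≤ f u) (hg : Measurable g) (hM : ∀ u, |g u| ≤ M)
    {ν C₁ C₂ : ℝ} (hν : 2 ≤ ν) (hgH : g ∈ HolderClass ν C₁) (hfH : f ∈ HolderClass (ν - 1) C₂)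
    (k : ℕ) (hk : ν ≤ 2 * k) {ε : ℝ} (hε : 0 < ε) :
    ∃ C, ∃ h₀ > 0, ∀ h, 0 < h → h ≤ h₀ → ∀ x ∈ Icc ε (1 - ε),
      |(popResidual K h f)^[k] g x| ≤ C * h ^ ν := by
  set h₀ := min 1 (ε / (k + 1)) with hh₀
  have hh₀' : 0 < h₀ := by positivity
  -- the index set consists of all pairs `(x, h)`, so that all constants are uniform in both
  let ι := {p : ℝ × ℝ // p.1 ∈ Icc ε (1 - ε) ∧ 0 < p.2 ∧ p.2 ≤ h₀}
  have hle1 : ∀ i : ι, i.1.2 ≤ 1 := fun i => i.2.2.2.trans (min_le_left _ _)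
  have hlek : ∀ i : ι, k * i.1.2 ≤ ε := fun i => by
    have h1 : i.1.2 ≤ ε / (k + 1) := i.2.2.2.trans (min_le_right _ _)
    rw [le_div_iff₀ (by positivity)] at h1
    linarith [i.2.2.1]
  let H : boundedFamilies ι := ⟨fun i => i.1.2, 1, fun i => by
    rw [abs_of_pos i.2.2.1]; exact hle1 i⟩
  have hx₀ : ∀ i : ι, i.1.1 ∈ Icc (0 : ℝ) 1 := fun i =>
    ⟨hε.le.trans i.2.1.1, by linarith [i.2.1.2]⟩
  have hmem : ∀ (i : ι) (y : ℝ), |y| ≤ k * i.1.2 → i.1.1 + y ∈ Icc (0 : ℝ) 1 := fun i y hy => by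
    have h1 := abs_le.1 (hy.trans (hlek i))
    exact ⟨by linarith [i.2.1.1], by linarith [i.2.1.2]⟩
  obtain ⟨q, hq⟩ := HolderClass.exists_taylor_family (by linarith) hfH (fun i : ι => i.1.1) hx₀
  obtain ⟨p₀, hp₀⟩ := HolderClass.exists_taylor_family (by linarith) hgH (fun i : ι => i.1.1) hx₀
  have hpow : ∀ (D s : ℝ), 0 ≤ s → ∀ (i : ι) (y : ℝ), |y| ≤ k * i.1.2 →
      |D| * |y| ^ s ≤ |D| * (k : ℝ) ^ s * i.1.2 ^ s := fun D s hs i y hy => by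
    rw [mul_assoc, ← Real.mul_rpow (Nat.cast_nonneg k) i.2.2.1.le]
    gcongr
  -- every step looks `h` further, so the expansion after `j` steps holds at distance `(k - j) h`
  have key : ∀ j l : ℕ, j + l = k → ∃ p : Polynomial (boundedFamilies ι), ∃ B, ∀ i y,
      |y| ≤ (l : ℝ) * i.1.2 → |(popResidual K i.1.2 f)^[j] g (i.1.1 + y) -
        i.1.2 ^ (2 * j) * boundedFamilies.ev i y p| ≤ B * i.1.2 ^ ν := by
    intro j
    induction j with
    | zero =>
      intro l hl
      obtain rfl : l = k := by omega
      refine ⟨p₀, |C₁| * (l : ℝ) ^ ν, fun i y hy => ?_⟩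
      simp only [Function.iterate_zero, id_eq, mul_zero, pow_zero, one_mul]
      exact (hp₀ i y (hmem i y hy)).trans (hpow C₁ ν (by linarith) i y hy)
    | succ j ih =>
      intro l hl
      obtain ⟨p, B, hp⟩ := ih (l + 1) (by omega)
      have hlk : ∀ (i : ι) (y : ℝ), |y| ≤ ((l : ℝ) + 1) * i.1.2 → |y| ≤ k * i.1.2 := by
        intro i y hy
        refine hy.trans (mul_le_mul_of_nonneg_right ?_ i.2.2.1.le)
        exact_mod_cast (by omega : l + 1 ≤ k)
      obtain ⟨p', B', h'⟩ := exists_residual_approx (h := H) hK (fun i => i.2.2.1) hle1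
        (ν := ν) (c := c) (B := |C₂| * (k : ℝ) ^ (ν - 1)) (A := A) (k := l) hν hc
        (Nat.cast_nonneg l)
        (F := fun i y => f (i.1.1 + y)) (fun i => hf.comp (by fun_prop))
        (fun i y hy => hfc _ (hmem i y (hlk i y hy)))
        (fun i y => by rw [abs_of_nonneg (hf0 _)]; exact hfA _)
        (q := q) (fun i y hy => (hq i y (hmem i y (hlk i y hy))).trans
          (hpow C₂ (ν - 1) (by linarith) i y (hlk i y hy)))
        (j := 2 * j) (G := fun i y => (popResidual K i.1.2 f)^[j] g (i.1.1 + y))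
        (fun i => (measurable_iterate_popResidual hK hf hg _ j).comp (by fun_prop))
        (fun i y => abs_iterate_popResidual_le hK hf hf0 hfA hg hM _ j _)
        (p := p) (B₁ := B) (fun i y hy => hp i y (by push_cast; exact hy))
      refine ⟨p', B', fun i y hy => ?_⟩
      have h1 := h' i y hy
      rw [localAvg_shift] at h1
      rw [Function.iterate_succ_apply', popResidual, mul_add]
      exact h1
  obtain ⟨p, B, hp⟩ := key k 0 (by omega)
  obtain ⟨Bp, hBp0, hBp⟩ := boundedFamilies.ev_bounded p 0
  refine ⟨B + Bp, h₀, hh₀', fun h hh hhle x hx => ?_⟩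
  have h1 := hp ⟨(x, h), hx, hh, hhle⟩ 0 (by simp)
  have h2 := hBp ⟨(x, h), hx, hh, hhle⟩ 0 (by simp)
  simp only [add_zero] at h1
  have h3 : h ^ (2 * k) ≤ h ^ ν := by
    rw [← Real.rpow_natCast h]
    exact Real.rpow_le_rpow_of_exponent_ge hh (hhle.trans (min_le_left _ _)) (by exact_mod_cast hk)
  have h4 : 0 < h ^ (2 * k) := by positivity
  have h5 : |h ^ (2 * k) * boundedFamilies.ev ⟨(x, h), hx, hh, hhle⟩ 0 p| ≤ h ^ ν * Bp := by
    rw [abs_mul, abs_of_pos h4]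
    exact mul_le_mul h3 h2 (abs_nonneg _) (by positivity)
  rw [abs_le] at h1 h5 ⊢
  constructor <;> linarith

end LocalAvg

/-! ### Boosting as a linear smoother -/

section Empirical

variable {K : ℝ → ℝ} {h : ℝ} {n : ℕ} {xs : Fin n → ℝ}

lemma scaledKernel_nonneg (hK : IsSmoothingKernel K) (hh : 0 < h) (u : ℝ) :
    0 ≤ scaledKernel K h u :=
  div_nonneg (hK.nonneg _) hh.le

lemma abs_le_of_scaledKernel_ne_zero (hK : IsSmoothingKernel K) (hh : 0 < h) {u : ℝ}
    (hu : scaledKernel K h u ≠ 0) : |u| ≤ h := by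
  have h1 : K (u / h) ≠ 0 := fun h0 => hu (by rw [scaledKernel, h0, zero_div])
  have h2 := hK.abs_le_one_of_ne_zero h1
  rwa [abs_div, abs_of_pos hh, div_le_one hh] at h2

lemma nadarayaWatson_sub (ys zs : Fin n → ℝ) (x : ℝ) :
    nadarayaWatson K h xs (fun i => ys i - zs i) x =
      nadarayaWatson K h xs ys x - nadarayaWatson K h xs zs x := by
  simp only [nadarayaWatson, mul_sub, Finset.sum_sub_distrib, sub_div]

/-- The Nadaraya-Watson smoother is an average of the responses whose covariates lie within
distance `h`. -/
lemma abs_nadarayaWatson_le (hK : IsSmoothingKernel K) (hh : 0 < h) {x b : ℝ}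
    (hD : 0 < ∑ i, scaledKernel K h (xs i - x)) {ys : Fin n → ℝ}
    (hys : ∀ i, |xs i - x| ≤ h → |ys i| ≤ b) : |nadarayaWatson K h xs ys x| ≤ b := by
  rw [nadarayaWatson, abs_div, abs_of_pos hD, div_le_iff₀ hD, Finset.mul_sum]
  refine (Finset.abs_sum_le_sum_abs _ _).trans (Finset.sum_le_sum fun i _ => ?_)
  rw [abs_mul, abs_of_nonneg (scaledKernel_nonneg hK hh _), mul_comm b]
  by_cases hi : scaledKernel K h (xs i - x) = 0
  · simp [hi]
  · exact mul_le_mul_of_nonneg_left (hys i (abs_le_of_scaledKernel_ne_zero hK hh hi))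
      (scaledKernel_nonneg hK hh _)

/-- The residual of the empirical smoother as an operator on functions, `g ↦ g - Ŝ g`. -/
noncomputable def empResidual (K : ℝ → ℝ) (h : ℝ) {n : ℕ} (xs : Fin n → ℝ) (g : ℝ → ℝ) (x : ℝ) :
    ℝ :=
  g x - nadarayaWatson K h xs (fun i => g (xs i)) x

/-- Boosting noiseless data leaves the iterated residual. -/
lemma boostedNW_eq_sub_iterate (g : ℝ → ℝ) (r : ℕ) (x : ℝ) :
    boostedNW K h xs (fun i => g (xs i)) r x = g x - (empResidual K h xs)^[r + 1] g x := by
  induction r generalizing x with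
  | zero => simp [boostedNW, empResidual]
  | succ r ih =>
    rw [boostedNW, Function.iterate_succ_apply']
    simp only [ih, sub_sub_cancel]
    rw [empResidual]
    ring

lemma mem_Icc_of_abs_sub_le {a b x y : ℝ} {k : ℕ}
    (hx : x ∈ Icc (a + (k + 1 : ℕ) * h) (b - (k + 1 : ℕ) * h)) (hy : |y - x| ≤ h) :
    y ∈ Icc (a + k * h) (b - k * h) := by
  have h1 := abs_le.1 hy
  have h2 := hx.1
  have h3 := hx.2
  push_cast at h2 h3
  constructor <;> linarith

lemma Icc_window_subset (hh : 0 < h) (a b : ℝ) (k : ℕ) :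
    Icc (a + k * h) (b - k * h) ⊆ Icc a b := by
  have h1 : 0 ≤ k * h := by positivity
  exact Icc_subset_Icc (by linarith) (by linarith)

/-- If the empirical smoother is within `δ` of an operator `T` at the iterated residuals of `T`,
then the iterated residuals of both are close, on windows which shrink by `h` at every step. -/
lemma abs_iterate_empResidual_sub_le (hK : IsSmoothingKernel K) (hh : 0 < h) {a b δ : ℝ}
    (hD : ∀ x ∈ Icc a b, 0 < ∑ i, scaledKernel K h (xs i - x))
    (R : (ℝ → ℝ) → ℝ → ℝ) (g : ℝ → ℝ) (k : ℕ)
    (hT : ∀ j < k, ∀ x ∈ Icc (a + (j + 1 : ℕ) * h) (b - (j + 1 : ℕ) * h),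
      |empResidual K h xs (R^[j] g) x - R (R^[j] g) x| ≤ δ) :
    ∀ x ∈ Icc (a + k * h) (b - k * h),
      |(empResidual K h xs)^[k] g x - R^[k] g x| ≤ (2 ^ k - 1) * δ := by
  induction k with
  | zero => intro x _; simp
  | succ k ih =>
    intro x hx
    have ih' := ih fun j hj => hT j (hj.trans (Nat.lt_succ_self k))
    have hself : x ∈ Icc (a + k * h) (b - k * h) :=
      mem_Icc_of_abs_sub_le hx (by simpa using hh.le)
    have h1 := ih' x hself
    have h2 := hT k (Nat.lt_succ_self k) x hx
    have h3 : |nadarayaWatson K h xs (fun i => (empResidual K h xs)^[k] g (xs i)) x -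
        nadarayaWatson K h xs (fun i => R^[k] g (xs i)) x| ≤ (2 ^ k - 1) * δ := by
      rw [← nadarayaWatson_sub]
      refine abs_nadarayaWatson_le hK hh (hD x (Icc_window_subset hh a b _ hx)) fun i hi => ?_
      exact ih' _ (mem_Icc_of_abs_sub_le hx hi)
    rw [Function.iterate_succ_apply', Function.iterate_succ_apply', pow_succ]
    simp only [empResidual] at h2 ⊢
    rw [abs_le] at h1 h2 h3 ⊢
    constructor <;> linarith

/-- The coefficient of the `i`-th response in the boosted smoother. -/
noncomputable def boostWeight (K : ℝ → ℝ) (h : ℝ) (xs : Fin n → ℝ) (r : ℕ) (x : ℝ) (i : Fin n) :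
    ℝ :=
  boostedNW K h xs (Pi.single i 1) r x

lemma nadarayaWatson_sum_mul (W : Fin n → Fin n → ℝ) (ys : Fin n → ℝ) (x : ℝ) :
    nadarayaWatson K h xs (fun k => ∑ i, W i k * ys i) x =
      ∑ i, nadarayaWatson K h xs (W i) x * ys i := by
  simp only [nadarayaWatson, div_mul_eq_mul_div, ← Finset.sum_div, Finset.mul_sum, Finset.sum_mul]
  rw [Finset.sum_comm]
  simp only [mul_assoc]

lemma boostedNW_eq_sum (ys : Fin n → ℝ) (r : ℕ) (x : ℝ) :
    boostedNW K h xs ys r x = ∑ i, boostWeight K h xs r x i * ys i := by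
  have hys : ys = fun k => ∑ i, (Pi.single i 1 : Fin n → ℝ) k * ys i := by
    ext k
    simp [Pi.single_apply]
  induction r generalizing x with
  | zero =>
    simp only [boostWeight, boostedNW]
    conv_lhs => rw [hys]
    rw [nadarayaWatson_sum_mul]
  | succ r ih =>
    simp only [boostWeight, boostedNW] at ih ⊢
    simp only [ih]
    rw [nadarayaWatson_sub]
    conv_lhs =>
      enter [2, 1]
      rw [hys]
    rw [nadarayaWatson_sum_mul, nadarayaWatson_sum_mul]
    simp only [nadarayaWatson_sub, add_mul, sub_mul, Finset.sum_add_distrib,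
      Finset.sum_sub_distrib]

lemma nadarayaWatson_single (x : ℝ) (i : Fin n) :
    nadarayaWatson K h xs (Pi.single i 1) x =
      scaledKernel K h (xs i - x) / ∑ k, scaledKernel K h (xs k - x) := by
  simp [nadarayaWatson, Pi.single_apply]

lemma boostWeight_succ (r : ℕ) (x : ℝ) (i : Fin n) :
    boostWeight K h xs (r + 1) x i = boostWeight K h xs r x i +
      (scaledKernel K h (xs i - x) / (∑ k, scaledKernel K h (xs k - x)) -
        nadarayaWatson K h xs (fun k => boostWeight K h xs r (xs k) i) x) := by
  rw [← nadarayaWatson_single, ← nadarayaWatson_sub]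
  rfl

/-- The weights of the boosted smoother are as small as those of the smoother itself, up to a
constant. -/
lemma abs_boostWeight_le (hK : IsSmoothingKernel K) (hh : 0 < h) {a b β : ℝ}
    (hD : ∀ x ∈ Icc a b, 0 < ∑ i, scaledKernel K h (xs i - x))
    (hβ : ∀ x ∈ Icc a b, ∀ i,
      scaledKernel K h (xs i - x) / (∑ k, scaledKernel K h (xs k - x)) ≤ β)
    (r : ℕ) : ∀ x ∈ Icc (a + r * h) (b - r * h), ∀ i,
      |boostWeight K h xs r x i| ≤ (2 ^ (r + 1) - 1) * β := by
  have hw0 : ∀ x ∈ Icc a b, ∀ i,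
      0 ≤ scaledKernel K h (xs i - x) / (∑ k, scaledKernel K h (xs k - x)) := fun x hx i =>
    div_nonneg (scaledKernel_nonneg hK hh _) (hD x hx).le
  induction r with
  | zero =>
    intro x hx i
    have hx' := Icc_window_subset hh a b _ hx
    simp only [boostWeight, boostedNW]
    rw [nadarayaWatson_single, abs_of_nonneg (hw0 x hx' i)]
    linarith [hβ x hx' i]
  | succ r ih =>
    intro x hx i
    have hx' := Icc_window_subset hh a b _ hx
    have h1 := ih x (mem_Icc_of_abs_sub_le hx (by simpa using hh.le)) i
    have h2 : |nadarayaWatson K h xs (fun k => boostWeight K h xs r (xs k) i) x| ≤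
        (2 ^ (r + 1) - 1) * β :=
      abs_nadarayaWatson_le hK hh (hD x hx') fun k hk => ih _ (mem_Icc_of_abs_sub_le hx hk) i
    have h3 := hw0 x hx' i
    have h4 := hβ x hx' i
    rw [boostWeight_succ, pow_succ]
    rw [abs_le] at h1 h2 ⊢
    constructor <;> linarith

/-- The weights of the boosted smoother are absolutely summable, uniformly in the data. -/
lemma sum_abs_boostWeight_le (hK : IsSmoothingKernel K) (hh : 0 < h) {a b : ℝ}
    (hD : ∀ x ∈ Icc a b, 0 < ∑ i, scaledKernel K h (xs i - x)) (r : ℕ) :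
    ∀ x ∈ Icc (a + r * h) (b - r * h), ∑ i, |boostWeight K h xs r x i| ≤ 2 ^ (r + 1) - 1 := by
  have hw : ∀ x ∈ Icc a b,
      ∑ i, |scaledKernel K h (xs i - x) / (∑ k, scaledKernel K h (xs k - x))| = 1 := fun x hx => by
    rw [Finset.sum_congr rfl fun i _ => abs_of_nonneg
      (div_nonneg (scaledKernel_nonneg hK hh _) (hD x hx).le), ← Finset.sum_div,
      div_self (hD x hx).ne']
  induction r with
  | zero =>
    intro x hx
    simp only [boostWeight, boostedNW, nadarayaWatson_single]
    rw [hw x (Icc_window_subset hh a b _ hx)]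
    norm_num
  | succ r ih =>
    intro x hx
    have hx' := Icc_window_subset hh a b _ hx
    have h1 := ih x (mem_Icc_of_abs_sub_le hx (by simpa using hh.le))
    have h2 : ∑ i, |nadarayaWatson K h xs (fun k => boostWeight K h xs r (xs k) i) x| ≤
        2 ^ (r + 1) - 1 := by
      have h3 : |nadarayaWatson K h xs (fun k => ∑ i, |boostWeight K h xs r (xs k) i| * 1) x| ≤
          2 ^ (r + 1) - 1 :=
        abs_nadarayaWatson_le hK hh (hD x hx') fun k hk => by
          simp only [mul_one]
          rw [abs_of_nonneg (Finset.sum_nonneg fun _ _ => abs_nonneg _)]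
          exact ih _ (mem_Icc_of_abs_sub_le hx hk)
      rw [nadarayaWatson_sum_mul (fun i k => |boostWeight K h xs r (xs k) i|)] at h3
      refine le_trans (Finset.sum_le_sum fun i _ => ?_) ((le_abs_self _).trans h3)
      rw [mul_one, nadarayaWatson, nadarayaWatson, abs_div, abs_of_pos (hD x hx')]
      refine div_le_div_of_nonneg_right ?_ (hD x hx').le
      refine (Finset.abs_sum_le_sum_abs _ _).trans (le_of_eq (Finset.sum_congr rfl fun k _ => ?_))
      rw [abs_mul, abs_of_nonneg (scaledKernel_nonneg hK hh _)]
    have h3 : ∀ i, |boostWeight K h xs (r + 1) x i| ≤ |boostWeight K h xs r x i| +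
        (|scaledKernel K h (xs i - x) / (∑ k, scaledKernel K h (xs k - x))| +
          |nadarayaWatson K h xs (fun k => boostWeight K h xs r (xs k) i) x|) := fun i => by
      rw [boostWeight_succ]
      exact (abs_add_le _ _).trans (add_le_add le_rfl (abs_sub _ _))
    refine (Finset.sum_le_sum fun i _ => h3 i).trans ?_
    rw [Finset.sum_add_distrib, Finset.sum_add_distrib, hw x hx', pow_succ]
    linarith

lemma sum_sq_boostWeight_le (hK : IsSmoothingKernel K) (hh : 0 < h) {a b β : ℝ} (hβ0 : 0 ≤ β)
    (hD : ∀ x ∈ Icc a b, 0 < ∑ i, scaledKernel K h (xs i - x))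
    (hβ : ∀ x ∈ Icc a b, ∀ i,
      scaledKernel K h (xs i - x) / (∑ k, scaledKernel K h (xs k - x)) ≤ β)
    (r : ℕ) {x : ℝ} (hx : x ∈ Icc (a + r * h) (b - r * h)) :
    ∑ i, boostWeight K h xs r x i ^ 2 ≤ (2 ^ (r + 1) - 1) ^ 2 * β := by
  have h0 : (0 : ℝ) ≤ 2 ^ (r + 1) - 1 := sub_nonneg.2 (one_le_pow₀ one_le_two)
  calc ∑ i, boostWeight K h xs r x i ^ 2
      ≤ ∑ i, ((2 ^ (r + 1) - 1) * β) * |boostWeight K h xs r x i| := by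
        refine Finset.sum_le_sum fun i _ => ?_
        rw [← sq_abs, sq]
        exact mul_le_mul_of_nonneg_right (abs_boostWeight_le hK hh hD hβ r x hx i) (abs_nonneg _)
    _ ≤ ((2 ^ (r + 1) - 1) * β) * (2 ^ (r + 1) - 1) := by
        rw [← Finset.mul_sum]
        exact mul_le_mul_of_nonneg_left (sum_abs_boostWeight_le hK hh hD r x hx) (by positivity)
    _ = _ := by ring

end Empirical

/-! ### Uniform deviations of kernel averages -/

section Concentration

variable {Ω : Type*} [MeasurableSpace Ω] {μ : Measure Ω} [IsProbabilityMeasure μ]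

/-- As `exp z ≤ 1 + z + z ^ 2` for `|z| ≤ 1`, the moment generating function of a bounded centred
variable is controlled by its variance. -/
lemma mgf_le_exp_of_bounded {W : Ω → ℝ} (hW : Measurable W) {B v t : ℝ}
    (hB : ∀ ω, |W ω| ≤ B) (h0 : ∫ ω, W ω ∂μ = 0) (hv : ∫ ω, W ω ^ 2 ∂μ ≤ v) (ht : 0 ≤ t)
    (htB : t * B ≤ 1) : mgf W μ t ≤ Real.exp (t ^ 2 * v) := by
  have i1 : Integrable W μ := Integrable.of_bound hW.aestronglyMeasurable B
    (Eventually.of_forall hB)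
  have i2 : Integrable (fun ω => W ω ^ 2) μ :=
    Integrable.of_bound (hW.pow_const 2).aestronglyMeasurable (B ^ 2)
      (Eventually.of_forall fun ω => by
        rw [Real.norm_eq_abs, abs_pow]; exact pow_le_pow_left₀ (abs_nonneg _) (hB ω) 2)
  have hle : ∀ ω, Real.exp (t * W ω) ≤ 1 + (t * W ω + t ^ 2 * W ω ^ 2) := fun ω => by
    have h1 : |t * W ω| ≤ 1 := by
      rw [abs_mul, abs_of_nonneg ht]
      exact (mul_le_mul_of_nonneg_left (hB ω) ht).trans htB
    have h2 := (abs_le.1 (Real.abs_exp_sub_one_sub_id_le h1)).2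
    rw [mul_pow] at h2
    linarith
  calc mgf W μ t ≤ ∫ ω, (1 + (t * W ω + t ^ 2 * W ω ^ 2)) ∂μ := by
        refine integral_mono_of_nonneg (Eventually.of_forall fun ω => (Real.exp_pos _).le)
          ((integrable_const _).add ((i1.const_mul _).add (i2.const_mul _)))
          (Eventually.of_forall hle)
    _ = 1 + t ^ 2 * ∫ ω, W ω ^ 2 ∂μ := by
        rw [integral_add (g := fun ω => t * W ω + t ^ 2 * W ω ^ 2) (integrable_const _)
          ((i1.const_mul _).add (i2.const_mul _)),
          integral_add (i1.const_mul _) (i2.const_mul _), integral_const_mul, integral_const_mul,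
          h0]
        simp
    _ ≤ t ^ 2 * v + 1 := by
        have := mul_le_mul_of_nonneg_left hv (sq_nonneg t)
        linarith
    _ ≤ Real.exp (t ^ 2 * v) := Real.add_one_le_exp _

/-- Bernstein's inequality for bounded centred variables, with the exponential parameter `t` left
free. -/
lemma measureReal_le_sum_le_exp {n : ℕ} {W : Fin n → Ω → ℝ} (hW : ∀ i, Measurable (W i))
    (hind : iIndepFun W μ) {B v t : ℝ} (hB : ∀ i ω, |W i ω| ≤ B) (h0 : ∀ i, ∫ ω, W i ω ∂μ = 0)
    (hv : ∀ i, ∫ ω, W i ω ^ 2 ∂μ ≤ v) (ht : 0 ≤ t) (htB : t * B ≤ 1) (a : ℝ) :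
    μ.real {ω | a ≤ ∑ i, W i ω} ≤ Real.exp (-t * a + n * (t ^ 2 * v)) := by
  have hint : Integrable (fun ω => Real.exp (t * ∑ i, W i ω)) μ := by
    refine Integrable.of_bound (C := Real.exp (t * (n * B))) (by fun_prop)
      (Eventually.of_forall fun ω => ?_)
    rw [Real.norm_eq_abs, Real.abs_exp]
    gcongr
    calc ∑ i, W i ω ≤ ∑ _i : Fin n, B :=
          Finset.sum_le_sum fun i _ => (le_abs_self _).trans (hB i ω)
      _ = n * B := by simp
  have h1 := measure_ge_le_exp_mul_mgf (μ := μ) (X := fun ω => ∑ i, W i ω) a ht hint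
  refine h1.trans ?_
  have h2 := hind.mgf_sum hW Finset.univ (t := t)
  have h3 : (∑ i, W i) = fun ω => ∑ i, W i ω := by ext ω; simp
  rw [h3] at h2
  rw [h2, Real.exp_add]
  refine mul_le_mul_of_nonneg_left ?_ (Real.exp_pos _).le
  calc ∏ i, mgf (W i) μ t ≤ ∏ _i : Fin n, Real.exp (t ^ 2 * v) :=
        Finset.prod_le_prod (fun i _ => mgf_nonneg)
          fun i _ => mgf_le_exp_of_bounded (hW i) (hB i) (h0 i) (hv i) ht htB
    _ = Real.exp (n * (t ^ 2 * v)) := by simp [Real.exp_nat_mul]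

lemma measure_le_abs_sum_le_exp {n : ℕ} {W : Fin n → Ω → ℝ} (hW : ∀ i, Measurable (W i))
    (hind : iIndepFun W μ) {B v t : ℝ} (hB : ∀ i ω, |W i ω| ≤ B) (h0 : ∀ i, ∫ ω, W i ω ∂μ = 0)
    (hv : ∀ i, ∫ ω, W i ω ^ 2 ∂μ ≤ v) (ht : 0 ≤ t) (htB : t * B ≤ 1) (a : ℝ) :
    μ {ω | a ≤ |∑ i, W i ω|} ≤ ENNReal.ofReal (2 * Real.exp (-t * a + n * (t ^ 2 * v))) := by
  have h1 := measureReal_le_sum_le_exp hW hind hB h0 hv ht htB a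
  have h2 := measureReal_le_sum_le_exp (W := fun i ω => -W i ω) (fun i => (hW i).neg)
    (hind.comp (fun _ x => -x) fun _ => measurable_neg) (fun i ω => by simpa using hB i ω)
    (fun i => by rw [integral_neg, h0 i, neg_zero]) (fun i => by simpa using hv i) ht htB a
  have hsub : {ω | a ≤ |∑ i, W i ω|} ⊆ {ω | a ≤ ∑ i, W i ω} ∪ {ω | a ≤ ∑ i, -W i ω} := by
    intro ω hω
    simpa only [Finset.sum_neg_distrib, mem_union, mem_ofPred_eq, le_abs] using hω
  rw [← ENNReal.ofReal_toReal (measure_ne_top μ {ω | a ≤ |∑ i, W i ω|})]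
  refine ENNReal.ofReal_le_ofReal ?_
  calc μ.real {ω | a ≤ |∑ i, W i ω|} ≤ _ := measureReal_mono hsub
    _ ≤ _ := measureReal_union_le _ _
    _ ≤ _ := by linarith

/-- The bandwidth conditions `h → 0` and `n h / log n → ∞`. -/
structure IsBandwidth (h : ℕ → ℝ) : Prop where
  pos : ∀ n, 0 < h n
  zero : Tendsto h atTop (𝓝 0)
  large : Tendsto (fun n : ℕ => (n : ℝ) * h n / Real.log n) atTop atTop

namespace IsBandwidth

variable {h : ℕ → ℝ}

lemma eventually_one_le_log : ∀ᶠ n : ℕ in atTop, 1 ≤ Real.log n :=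
  (Real.tendsto_log_atTop.comp tendsto_natCast_atTop_atTop).eventually_ge_atTop 1

lemma eventually_one_le_mul (hh : IsBandwidth h) : ∀ᶠ n : ℕ in atTop, 1 ≤ n * h n := by
  filter_upwards [hh.large.eventually_ge_atTop 1, eventually_one_le_log] with n h1 h2
  rw [le_div_iff₀ (by linarith), one_mul] at h1
  exact h2.trans h1

lemma tendsto_sqrt_log_div (hh : IsBandwidth h) :
    Tendsto (fun n : ℕ => √(Real.log n / (n * h n))) atTop (𝓝 0) := by
  have h1 := hh.large.inv_tendsto_atTop
  have h2 := (Real.continuous_sqrt.tendsto 0).comp h1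
  rw [Real.sqrt_zero] at h2
  refine h2.congr fun n => ?_
  simp [inv_div]

end IsBandwidth

/-- Uniform law of large numbers for kernel-type averages: if the summands are bounded, have
variance of order `h` and vary at most like `h ^ (-3)` with the location `x`, then their averages
are `O(√(h log n / n))` uniformly, with probability tending to one. Bernstein's inequality is used
on a grid of mesh `n ^ (-4)`. -/
theorem exists_tendsto_measure_sup_average {X : ℕ → Ω → ℝ} (hX : ∀ i, Measurable (X i))
    (hind : iIndepFun X μ) (hid : ∀ i, IdentDistrib (X i) (X 0) μ μ) {h : ℕ → ℝ}
    (hh : IsBandwidth h) (Z : ℕ → ℝ → ℝ → ℝ) (J : ℕ → Set ℝ) (hJ : ∀ n, J n ⊆ Icc 0 1) {B : ℝ}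
    (hB0 : 0 ≤ B)
    (hZ : ∀ᶠ n in atTop, ∀ x ∈ J n, Measurable (Z n x) ∧ (∀ ξ, |Z n x ξ| ≤ B) ∧
      ∫ ω, Z n x (X 0 ω) ∂μ = 0 ∧ ∫ ω, Z n x (X 0 ω) ^ 2 ∂μ ≤ B * h n)
    (hlip : ∀ᶠ n in atTop, ∀ x ∈ J n, ∀ x' ∈ J n, ∀ ξ,
      |Z n x ξ - Z n x' ξ| ≤ B * |x - x'| / h n ^ 3) :
    ∃ M, 0 ≤ M ∧ Tendsto (fun n : ℕ => μ {ω | ∃ x ∈ J n, M * √(h n * Real.log n / n) <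
      |(∑ i : Fin n, Z n x (X i ω)) / n|}) atTop (𝓝 0) := by
  -- With `B + 5` the probability of a deviation at one grid point is at most `2 n ^ (-5)`, which
  -- beats the number of grid points; the second `B` is for the oscillation between grid points.
  refine ⟨(B + 5) + B, by positivity, ?_⟩
  have hlim : Tendsto (fun n : ℕ => ENNReal.ofReal (4 * (n : ℝ)⁻¹)) atTop (𝓝 0) := by
    have := ENNReal.tendsto_ofReal ((tendsto_inv_atTop_nhds_zero_nat (𝕜 := ℝ)).const_mul 4)
    simpa using this
  refine tendsto_of_tendsto_of_tendsto_of_le_of_le' tendsto_const_nhds hlim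
    (Eventually.of_forall fun n => zero_le) ?_
  have hB1 : ∀ᶠ n : ℕ in atTop, √(Real.log n / (n * h n)) * B ≤ 1 := by
    have := hh.tendsto_sqrt_log_div.mul_const B
    rw [zero_mul] at this
    exact this.eventually_le_const zero_lt_one
  filter_upwards [hZ, hlip, hB1, hh.eventually_one_le_mul, IsBandwidth.eventually_one_le_log,
    eventually_ge_atTop 1] with n hZ hlip hB1 hnh hlog hn1
  have hn0 : (0 : ℝ) < n := by exact_mod_cast hn1
  have hn1' : (1 : ℝ) ≤ n := by exact_mod_cast hn1
  have hη := hh.pos n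
  set η := h n
  set ℓ := Real.log n with hℓ
  have hℓ0 : 0 < ℓ := by linarith
  set t := √(ℓ / (n * η)) with ht
  set ρ := √(η * ℓ / n) with hρ
  have hρn : (n : ℝ)⁻¹ ≤ ρ := by
    rw [hρ]
    refine Real.le_sqrt_of_sq_le ?_
    rw [inv_pow, inv_eq_one_div, div_le_div_iff₀ (by positivity) hn0]
    have e0 : 1 * 1 ≤ (n * η) * ℓ := mul_le_mul hnh hlog zero_le_one (by positivity)
    nlinarith
  have htρ : n * (t * ρ) = ℓ := by
    rw [ht, hρ, ← Real.sqrt_mul (by positivity),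
      show ℓ / (n * η) * (η * ℓ / n) = (ℓ / n) ^ 2 by field_simp, Real.sqrt_sq (by positivity)]
    field_simp
  have ht2 : n * (t ^ 2 * (B * η)) = B * ℓ := by
    rw [ht, Real.sq_sqrt (by positivity)]
    field_simp
  -- the deviation at one grid point
  have hpt : ∀ x ∈ J n, μ {ω | (B + 5) * ρ * n ≤ |∑ i : Fin n, Z n x (X i ω)|} ≤
      ENNReal.ofReal (2 * ((n : ℝ) ^ 5)⁻¹) := by
    intro x hx
    obtain ⟨hm, hbd, hmean, hvar⟩ := hZ x hx
    have hid' : ∀ i, IdentDistrib (fun ω => Z n x (X i ω)) (fun ω => Z n x (X 0 ω)) μ μ :=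
      fun i => (hid i).comp hm
    have h1 := measure_le_abs_sum_le_exp (W := fun (i : Fin n) ω => Z n x (X i ω)) (μ := μ)
      (fun i => hm.comp (hX i))
      ((hind.precomp Fin.val_injective).comp (fun _ => Z n x) fun _ => hm)
      (fun i ω => hbd _) (fun i => by rw [(hid' i).integral_eq]; exact hmean)
      (v := B * η) (fun i => by
        have := ((hid' i).comp (measurable_id.pow_const 2)).integral_eq
        simp only [Function.comp_def, id] at this
        rw [this]
        exact hvar) (Real.sqrt_nonneg _) hB1 ((B + 5) * ρ * n)
    refine h1.trans (ENNReal.ofReal_le_ofReal ?_)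
    rw [← ht, ht2, show -t * ((B + 5) * ρ * n) + B * ℓ = -(5 * ℓ) by
      linear_combination (-(B + 5)) * htρ, Real.exp_neg, hℓ]
    rw [show (5 : ℝ) * Real.log n = (5 : ℕ) * Real.log n by norm_num, Real.exp_nat_mul,
      Real.exp_log hn0]
  have hcell : {ω | ∃ x ∈ J n, ((B + 5) + B) * ρ < |(∑ i : Fin n, Z n x (X i ω)) / n|} ⊆
      ⋃ c ∈ Finset.range (n ^ 4 + 1), {ω | ∃ x ∈ J n, ⌊x * (n : ℝ) ^ 4⌋₊ = c ∧
        ((B + 5) + B) * ρ < |(∑ i : Fin n, Z n x (X i ω)) / n|} := by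
    rintro ω ⟨x, hx, hω⟩
    simp only [mem_iUnion, Finset.mem_range]
    refine ⟨⌊x * (n : ℝ) ^ 4⌋₊, ?_, x, hx, rfl, hω⟩
    rw [Nat.lt_succ_iff]
    refine Nat.floor_le_of_le ?_
    push_cast
    exact mul_le_of_le_one_left (by positivity) (hJ n hx).2
  refine (measure_mono hcell).trans ((measure_biUnion_finset_le _ _).trans ?_)
  have hone : ∀ c ∈ Finset.range (n ^ 4 + 1), μ {ω | ∃ x ∈ J n, ⌊x * (n : ℝ) ^ 4⌋₊ = c ∧
        ((B + 5) + B) * ρ < |(∑ i : Fin n, Z n x (X i ω)) / n|} ≤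
      ENNReal.ofReal (2 * ((n : ℝ) ^ 5)⁻¹) := by
    intro c _
    by_cases hc : ∃ x₀ ∈ J n, ⌊x₀ * (n : ℝ) ^ 4⌋₊ = c
    · obtain ⟨x₀, hx₀, hc₀⟩ := hc
      refine (measure_mono ?_).trans (hpt x₀ hx₀)
      rintro ω ⟨x, hx, hxc, hω⟩
      have hx0 : 0 ≤ x * (n : ℝ) ^ 4 := mul_nonneg (hJ n hx).1 (by positivity)
      have hx0' : 0 ≤ x₀ * (n : ℝ) ^ 4 := mul_nonneg (hJ n hx₀).1 (by positivity)
      have hdist : |x - x₀| * (n : ℝ) ^ 4 ≤ 1 := by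
        have e0 : |(n : ℝ) ^ 4| = (n : ℝ) ^ 4 := abs_of_pos (by positivity)
        rw [← e0, ← abs_mul, sub_mul, abs_le]
        have e1 := Nat.floor_le hx0
        have e2 := Nat.lt_floor_add_one (x * (n : ℝ) ^ 4)
        have e3 := Nat.floor_le hx0'
        have e4 := Nat.lt_floor_add_one (x₀ * (n : ℝ) ^ 4)
        rw [hxc] at e1 e2
        rw [hc₀] at e3 e4
        constructor <;> linarith
      have hdiff : |(∑ i : Fin n, Z n x (X i ω)) - ∑ i : Fin n, Z n x₀ (X i ω)| ≤ B * ρ * n := by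
        rw [← Finset.sum_sub_distrib]
        refine (Finset.abs_sum_le_sum_abs _ _).trans ?_
        have e1 : ∀ i ∈ (Finset.univ : Finset (Fin n)),
            |Z n x (X i ω) - Z n x₀ (X i ω)| ≤ B * ρ := fun i _ => by
          refine (hlip x hx x₀ hx₀ _).trans ?_
          rw [mul_div_assoc]
          refine mul_le_mul_of_nonneg_left (le_trans ?_ hρn) hB0
          rw [div_le_iff₀ (by positivity), inv_mul_eq_div, le_div_iff₀ hn0]
          have e2 : 1 ≤ (n * η) ^ 3 := one_le_pow₀ hnh
          have e3 : |x - x₀| * n * (n : ℝ) ^ 3 ≤ η ^ 3 * (n : ℝ) ^ 3 := by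
            calc _ = |x - x₀| * (n : ℝ) ^ 4 := by ring
              _ ≤ 1 := hdist
              _ ≤ _ := e2
              _ = _ := by ring
          exact le_of_mul_le_mul_right e3 (by positivity)
        refine (Finset.sum_le_sum e1).trans (le_of_eq ?_)
        simp
        ring
      rw [abs_div, abs_of_pos hn0, lt_div_iff₀ hn0] at hω
      have e5 := abs_sub_abs_le_abs_sub (∑ i : Fin n, Z n x (X i ω)) (∑ i : Fin n, Z n x₀ (X i ω))
      simp only [mem_ofPred_eq]
      linarith
    · refine (measure_mono_null ?_ (measure_empty (μ := μ))).le.trans (zero_le)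
      rintro ω ⟨x, hx, hxc, -⟩
      exact hc ⟨x, hx, hxc⟩
  refine (Finset.sum_le_sum hone).trans ?_
  rw [Finset.sum_const, Finset.card_range, nsmul_eq_mul, ← ENNReal.ofReal_natCast,
    ← ENNReal.ofReal_mul (by positivity)]
  refine ENNReal.ofReal_le_ofReal ?_
  push_cast
  have e6 : (1 : ℝ) ≤ (n : ℝ) ^ 4 := one_le_pow₀ hn1'
  rw [← div_eq_mul_inv, ← div_eq_mul_inv, mul_div_assoc', div_le_div_iff₀ (by positivity) hn0]
  nlinarith

end Concentration

/-! ### Conditional moments given the covariates -/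

section Conditional

variable {Ω : Type*} [MeasurableSpace Ω] {μ : Measure Ω} [IsProbabilityMeasure μ]

lemma measurable_firstN {X : ℕ → Ω → ℝ} (hX : ∀ i, Measurable (X i)) (n : ℕ) :
    Measurable (firstN X n) :=
  measurable_pi_iff.2 fun i => hX i

/-- A conditional mean is nonpositive if the integrals over all events of the conditioning variable
are. -/
lemma ae_condMeanGiven_nonpos {n : ℕ} {U V : Ω → Fin n → ℝ} (hU : Measurable U)
    (hV : Measurable V) {φ : (Fin n → ℝ) → (Fin n → ℝ) → ℝ}
    (hφ : Measurable (Function.uncurry φ)) (hint : Integrable (fun ω => φ (U ω) (V ω)) μ)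
    (hle : ∀ A, MeasurableSet A → ∫ ω in U ⁻¹' A, φ (U ω) (V ω) ∂μ ≤ 0) :
    ∀ᵐ ω ∂μ, condMeanGiven μ U V φ ω ≤ 0 := by
  have hmap : Integrable (Function.uncurry φ) (μ.map fun ω => (U ω, V ω)) :=
    (integrable_map_measure hφ.aestronglyMeasurable (hU.prodMk hV).aemeasurable).2 hint
  have hg : Integrable (fun u => ∫ v, φ u v ∂condDistrib V U μ u) (μ.map U) :=
    hmap.integral_condDistrib_map hV.aemeasurable
  have hae : (fun u => ∫ v, φ u v ∂condDistrib V U μ u) ≤ᵐ[μ.map U] 0 := by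
    refine ae_le_of_forall_setIntegral_le hg (integrable_zero _ _ _) fun A hA _ => ?_
    simp only [Pi.zero_apply, integral_zero]
    rw [setIntegral_map hA hg.1 hU.aemeasurable]
    have h1 := condMeanGiven_ae_eq_condExp μ U V hU hV φ hφ hint
    calc ∫ ω in U ⁻¹' A, condMeanGiven μ U V φ ω ∂μ
        = ∫ ω in U ⁻¹' A, (μ[fun ω => φ (U ω) (V ω) | MeasurableSpace.comap U inferInstance]) ω ∂μ :=
          integral_congr_ae (ae_restrict_of_ae h1)
      _ = ∫ ω in U ⁻¹' A, φ (U ω) (V ω) ∂μ := setIntegral_condExp hU.comap_le hint ⟨A, hA, rfl⟩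
      _ ≤ 0 := hle A hA
  exact ae_of_ae_map hU.aemeasurable hae

lemma ae_condMeanGiven_eq_zero {n : ℕ} {U V : Ω → Fin n → ℝ} (hU : Measurable U)
    (hV : Measurable V) {φ : (Fin n → ℝ) → (Fin n → ℝ) → ℝ}
    (hφ : Measurable (Function.uncurry φ)) (hint : Integrable (fun ω => φ (U ω) (V ω)) μ)
    (h0 : ∀ A, MeasurableSet A → ∫ ω in U ⁻¹' A, φ (U ω) (V ω) ∂μ = 0) :
    ∀ᵐ ω ∂μ, condMeanGiven μ U V φ ω = 0 := by
  filter_upwards [ae_condMeanGiven_nonpos hU hV hφ hint fun A hA => (h0 A hA).le,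
    ae_condMeanGiven_nonpos hU hV (φ := fun u v => -φ u v) hφ.neg hint.neg fun A hA => by
      rw [integral_neg, h0 A hA, neg_zero]] with ω h1 h2
  refine le_antisymm h1 ?_
  simp only [condMeanGiven, integral_neg] at h2 ⊢
  linarith

lemma ae_integrable_condDistrib {n : ℕ} {U V : Ω → Fin n → ℝ} (hU : Measurable U)
    (hV : Measurable V) {φ : (Fin n → ℝ) → (Fin n → ℝ) → ℝ}
    (hφ : Measurable (Function.uncurry φ)) (hint : Integrable (fun ω => φ (U ω) (V ω)) μ) :
    ∀ᵐ ω ∂μ, Integrable (φ (U ω)) (condDistrib V U μ (U ω)) :=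
  ((integrable_map_measure hφ.aestronglyMeasurable (hU.prodMk hV).aemeasurable).2
    hint).condDistrib_ae hU.aemeasurable hV.aemeasurable

section Iid

variable {X Y : ℕ → Ω → ℝ}

/-- In an i.i.d. sample, the other observations are irrelevant for the conditional mean of a
function `φ` of the `i`-th pair: by Fubini it suffices to integrate `φ` over the events of the
`i`-th covariate, with the other observations frozen. The factor `w` depends on these only. -/
lemma setIntegral_firstN_nonpos (hX : ∀ i, Measurable (X i)) (hY : ∀ i, Measurable (Y i))
    (hindep : iIndepFun (fun i ω => (X i ω, Y i ω)) μ)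
    (hident : ∀ i, IdentDistrib (fun ω => (X i ω, Y i ω)) (fun ω => (X 0 ω, Y 0 ω)) μ μ)
    {n : ℕ} (i : Fin n) {φ : ℝ × ℝ → ℝ} (hφ : Measurable φ)
    (hφi : Integrable (fun ω => φ (X 0 ω, Y 0 ω)) μ)
    {w : (((Finset.range n).erase i : Finset ℕ) → ℝ × ℝ) → ℝ} (hw : Measurable w)
    (hwi : Integrable (fun ω => w fun j => (X j ω, Y j ω)) μ)
    (hle : ∀ t S, MeasurableSet S → w t * ∫ ω in X 0 ⁻¹' S, φ (X 0 ω, Y 0 ω) ∂μ ≤ 0)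
    {A : Set (Fin n → ℝ)} (hA : MeasurableSet A) :
    ∫ ω in firstN X n ⁻¹' A, (w fun j => (X j ω, Y j ω)) * φ (X i ω, Y i ω) ∂μ ≤ 0 := by
  let I : Finset ℕ := (Finset.range n).erase i
  let T : Ω → I → ℝ × ℝ := fun ω j => (X j ω, Y j ω)
  let P : Ω → ℝ × ℝ := fun ω => (X i ω, Y i ω)
  have hT : Measurable T := measurable_pi_iff.2 fun j => (hX j).prodMk (hY j)
  have hP : Measurable P := (hX i).prodMk (hY i)
  have hmemI : ∀ k : Fin n, (k : ℕ) ≠ i → (k : ℕ) ∈ I := fun k hk =>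
    Finset.mem_erase.2 ⟨hk, Finset.mem_range.2 k.2⟩
  -- the covariates as a function of the `i`-th one and of the remaining observations
  let rec' : ℝ → (I → ℝ × ℝ) → Fin n → ℝ := fun x t k =>
    if hk : (k : ℕ) = i then x else (t ⟨k, hmemI k hk⟩).1
  have hrec : Measurable fun z : (ℝ × ℝ) × (I → ℝ × ℝ) => rec' z.1.1 z.2 := by
    refine measurable_pi_iff.2 fun k => ?_
    by_cases hk : (k : ℕ) = i
    · simp only [rec', hk, dite_true]
      fun_prop
    · simp only [rec', hk, dite_false]
      fun_prop
  have hrecU : ∀ ω, rec' (X i ω) (T ω) = firstN X n ω := fun ω => by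
    ext k
    by_cases hk : (k : ℕ) = i
    · simp [rec', hk, firstN]
    · simp [rec', hk, firstN, T]
  have hind : IndepFun P T μ := by
    have h1 := hindep.indepFun_finset {(i : ℕ)} I (by simp [I])
      fun j => (hX j).prodMk (hY j)
    have h2 : Measurable fun g : (({(i : ℕ)} : Finset ℕ) → ℝ × ℝ) =>
        g ⟨(i : ℕ), Finset.mem_singleton_self _⟩ := measurable_pi_apply _
    exact h1.comp h2 measurable_id
  let F : (ℝ × ℝ) × (I → ℝ × ℝ) → ℝ := fun z =>
    {z : (ℝ × ℝ) × (I → ℝ × ℝ) | rec' z.1.1 z.2 ∈ A}.indicator (fun z => w z.2 * φ z.1) z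
  have hsetm : MeasurableSet {z : (ℝ × ℝ) × (I → ℝ × ℝ) | rec' z.1.1 z.2 ∈ A} := hrec hA
  have hFm : Measurable F :=
    ((hw.comp measurable_snd).mul (hφ.comp measurable_fst)).indicator hsetm
  have hint : Integrable (fun ω => w (T ω) * φ (P ω)) μ :=
    (hind.symm.comp hw hφ).integrable_mul hwi (((hident i).comp hφ).integrable_iff.2 hφi)
  have hAm : MeasurableSet (firstN X n ⁻¹' A) := measurable_firstN hX n hA
  have hFeq : ∀ ω, F (P ω, T ω) = (firstN X n ⁻¹' A).indicator (fun ω => w (T ω) * φ (P ω)) ω := by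
    intro ω
    have hmem : (P ω, T ω) ∈ {z : (ℝ × ℝ) × (I → ℝ × ℝ) | rec' z.1.1 z.2 ∈ A} ↔
        ω ∈ firstN X n ⁻¹' A := by
      rw [mem_ofPred_eq, mem_preimage, hrecU]
    by_cases hω : ω ∈ firstN X n ⁻¹' A
    · rw [indicator_of_mem hω]
      exact indicator_of_mem (hmem.2 hω) _
    · rw [indicator_of_notMem hω]
      exact indicator_of_notMem (fun h => hω (hmem.1 h)) _
  have hFint : Integrable (fun ω => F (P ω, T ω)) μ := by
    simp only [hFeq]
    exact hint.indicator hAm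
  have hprod := (indepFun_iff_map_prod_eq_prod_map_map hP.aemeasurable hT.aemeasurable).1 hind
  have hFint' : Integrable F ((μ.map P).prod (μ.map T)) := by
    rw [← hprod]
    exact (integrable_map_measure hFm.aestronglyMeasurable (hP.prodMk hT).aemeasurable).2 hFint
  calc ∫ ω in firstN X n ⁻¹' A, w (T ω) * φ (P ω) ∂μ
      = ∫ ω, F (P ω, T ω) ∂μ := by
        simp only [hFeq]
        rw [integral_indicator hAm]
    _ = ∫ z, F z ∂((μ.map P).prod (μ.map T)) := by
        rw [← hprod, integral_map (hP.prodMk hT).aemeasurable hFm.aestronglyMeasurable]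
    _ = ∫ t, ∫ p, F (p, t) ∂(μ.map P) ∂(μ.map T) := integral_prod_symm _ hFint'
    _ ≤ 0 := by
        refine integral_nonpos fun t => ?_
        have hS : MeasurableSet {x | rec' x t ∈ A} := by
          have : Measurable fun x : ℝ => rec' x t :=
            hrec.comp (f := fun x : ℝ => (((x, 0) : ℝ × ℝ), t)) (by fun_prop)
          exact this hA
        have hFt : Measurable fun p => F (p, t) := hFm.comp (by fun_prop)
        have hPeq : μ.map P = μ.map fun ω => (X 0 ω, Y 0 ω) := (hident i).map_eq
        rw [hPeq, integral_map ((hX 0).prodMk (hY 0)).aemeasurable hFt.aestronglyMeasurable]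
        have h2 : ∀ ω, F ((X 0 ω, Y 0 ω), t) = (X 0 ⁻¹' {x | rec' x t ∈ A}).indicator
            (fun ω => w t * φ (X 0 ω, Y 0 ω)) ω := fun ω => rfl
        simp only [h2]
        rw [integral_indicator (hX 0 hS), integral_const_mul]
        exact hle t _ hS

variable {m : ℝ → ℝ}

lemma setIntegral_response_sub (hX : ∀ i, Measurable (X i)) (hY_int : Integrable (Y 0) μ)
    (hm_reg : μ[Y 0 | MeasurableSpace.comap (X 0) inferInstance] =ᵐ[μ] fun ω => m (X 0 ω))
    {S : Set ℝ} (hS : MeasurableSet S) : ∫ ω in X 0 ⁻¹' S, (Y 0 ω - m (X 0 ω)) ∂μ = 0 := by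
  have hmi : Integrable (fun ω => m (X 0 ω)) μ := integrable_condExp.congr hm_reg
  rw [integral_sub hY_int.integrableOn hmi.integrableOn,
    ← setIntegral_condExp (hX 0).comap_le hY_int ⟨S, hS, rfl⟩,
    integral_congr_ae (ae_restrict_of_ae hm_reg), sub_self]

lemma setIntegral_sq_response_sub (hX : ∀ i, Measurable (X i))
    (hm_reg : μ[Y 0 | MeasurableSpace.comap (X 0) inferInstance] =ᵐ[μ] fun ω => m (X 0 ω))
    {B : ℝ} (hY2 : MemLp (Y 0) 2 μ)
    (hvar : ∀ᵐ ω ∂μ, condVar (MeasurableSpace.comap (X 0) inferInstance) (Y 0) μ ω ≤ B)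
    {S : Set ℝ} (hS : MeasurableSet S) :
    ∫ ω in X 0 ⁻¹' S, ((Y 0 ω - m (X 0 ω)) ^ 2 - B) ∂μ ≤ 0 := by
  have hce : MemLp (μ[Y 0 | MeasurableSpace.comap (X 0) inferInstance]) 2 μ := hY2.condExp one_le_two
  have hsq := (hY2.sub hce).integrable_sq
  have hsq' : Integrable (fun ω => (Y 0 ω - m (X 0 ω)) ^ 2) μ := by
    refine hsq.congr ?_
    filter_upwards [hm_reg] with ω h
    rw [Pi.sub_apply, h]
  have h1 := setIntegral_condVar (hm := (hX 0).comap_le) (X := Y 0) (μ := μ) hsq ⟨S, hS, rfl⟩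
  have h2 : ∫ ω in X 0 ⁻¹' S, (Y 0 ω - m (X 0 ω)) ^ 2 ∂μ =
      ∫ ω in X 0 ⁻¹' S, condVar (MeasurableSpace.comap (X 0) inferInstance) (Y 0) μ ω ∂μ := by
    rw [h1]
    refine integral_congr_ae (ae_restrict_of_ae ?_)
    filter_upwards [hm_reg] with ω h
    rw [h]
  rw [integral_sub hsq'.integrableOn (integrable_const _), h2]
  have h3 := setIntegral_mono_ae (μ := μ) (s := X 0 ⁻¹' S) integrable_condVar.integrableOn
    (integrable_const B).integrableOn hvar
  linarith

omit [IsProbabilityMeasure μ] in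
lemma integrable_response_sub (hm : Measurable m) (hY_int : Integrable (Y 0) μ)
    (hident : ∀ i, IdentDistrib (fun ω => (X i ω, Y i ω)) (fun ω => (X 0 ω, Y 0 ω)) μ μ)
    (hm_reg : μ[Y 0 | MeasurableSpace.comap (X 0) inferInstance] =ᵐ[μ] fun ω => m (X 0 ω))
    (i : ℕ) : Integrable (fun ω => Y i ω - m (X i ω)) μ := by
  have hmi : Integrable (fun ω => m (X 0 ω)) μ := integrable_condExp.congr hm_reg
  exact ((hident i).comp (u := fun p : ℝ × ℝ => p.2 - m p.1) (by fun_prop)).integrable_iff.2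
    (hY_int.sub hmi)

/-- Under the regular conditional distribution of the responses given the covariates, the
responses have means `m (X i)`. -/
lemma ae_integral_response_sub (hX : ∀ i, Measurable (X i)) (hY : ∀ i, Measurable (Y i))
    (hindep : iIndepFun (fun i ω => (X i ω, Y i ω)) μ)
    (hident : ∀ i, IdentDistrib (fun ω => (X i ω, Y i ω)) (fun ω => (X 0 ω, Y 0 ω)) μ μ)
    (hm : Measurable m) (hY_int : Integrable (Y 0) μ)
    (hm_reg : μ[Y 0 | MeasurableSpace.comap (X 0) inferInstance] =ᵐ[μ] fun ω => m (X 0 ω))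
    (n : ℕ) : ∀ᵐ ω ∂μ, ∀ i : Fin n,
      Integrable (fun v : Fin n → ℝ => v i - m (X i ω))
        (condDistrib (firstN Y n) (firstN X n) μ (firstN X n ω)) ∧
      ∫ v, (v i - m (X i ω)) ∂(condDistrib (firstN Y n) (firstN X n) μ (firstN X n ω)) = 0 := by
  refine ae_all_iff.2 fun i => ?_
  have hint := integrable_response_sub hm hY_int hident hm_reg
  have hφm : Measurable (Function.uncurry fun (u v : Fin n → ℝ) => v i - m (u i)) := by
    simp only [Function.uncurry_def]
    fun_prop
  have hset := fun S (hS : MeasurableSet S) => setIntegral_response_sub hX hY_int hm_reg hS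
  refine (ae_integrable_condDistrib (measurable_firstN hX n) (measurable_firstN hY n) hφm
    (hint i)).and (ae_condMeanGiven_eq_zero (measurable_firstN hX n) (measurable_firstN hY n) hφm
    (hint i) fun A hA => le_antisymm ?_ ?_)
  · have h1 := setIntegral_firstN_nonpos hX hY hindep hident i (φ := fun p => p.2 - m p.1)
      (by fun_prop) (hint 0) (w := fun _ => 1) measurable_const (integrable_const _)
      (fun _ S hS => by rw [hset S hS, mul_zero]) hA
    simpa only [one_mul, firstN] using h1
  · have h1 := setIntegral_firstN_nonpos hX hY hindep hident i (φ := fun p => p.2 - m p.1)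
      (by fun_prop) (hint 0) (w := fun _ => -1) measurable_const (integrable_const _)
      (fun _ S hS => by rw [hset S hS, mul_zero]) hA
    simp only [neg_mul, one_mul, integral_neg] at h1
    exact neg_nonpos.1 h1

omit [IsProbabilityMeasure μ] in
lemma memLp_response_sub (hm : Measurable m)
    (hident : ∀ i, IdentDistrib (fun ω => (X i ω, Y i ω)) (fun ω => (X 0 ω, Y 0 ω)) μ μ)
    (hm_reg : μ[Y 0 | MeasurableSpace.comap (X 0) inferInstance] =ᵐ[μ] fun ω => m (X 0 ω))
    (hY2 : MemLp (Y 0) 2 μ) (i : ℕ) : MemLp (fun ω => Y i ω - m (X i ω)) 2 μ := by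
  have hce : MemLp (μ[Y 0 | MeasurableSpace.comap (X 0) inferInstance]) 2 μ := hY2.condExp one_le_two
  exact ((hident i).comp (u := fun p : ℝ × ℝ => p.2 - m p.1) (by fun_prop)).symm.memLp_snd
    (hY2.sub (hce.ae_eq hm_reg))

/-- Under the regular conditional distribution of the responses given the covariates, the errors
are uncorrelated, with variances bounded by the bound on the conditional variance. -/
lemma ae_integral_mul_response_sub (hX : ∀ i, Measurable (X i)) (hY : ∀ i, Measurable (Y i))
    (hindep : iIndepFun (fun i ω => (X i ω, Y i ω)) μ)
    (hident : ∀ i, IdentDistrib (fun ω => (X i ω, Y i ω)) (fun ω => (X 0 ω, Y 0 ω)) μ μ)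
    (hm : Measurable m)
    (hm_reg : μ[Y 0 | MeasurableSpace.comap (X 0) inferInstance] =ᵐ[μ] fun ω => m (X 0 ω))
    {B : ℝ} (hY2 : MemLp (Y 0) 2 μ)
    (hvar : ∀ᵐ ω ∂μ, condVar (MeasurableSpace.comap (X 0) inferInstance) (Y 0) μ ω ≤ B)
    (n : ℕ) : ∀ᵐ ω ∂μ, ∀ i j : Fin n,
      Integrable (fun v : Fin n → ℝ => (v i - m (X i ω)) * (v j - m (X j ω)))
        (condDistrib (firstN Y n) (firstN X n) μ (firstN X n ω)) ∧
      (i ≠ j → ∫ v, (v i - m (X i ω)) * (v j - m (X j ω))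
        ∂(condDistrib (firstN Y n) (firstN X n) μ (firstN X n ω)) = 0) ∧
      (i = j → ∫ v, (v i - m (X i ω)) * (v j - m (X j ω))
        ∂(condDistrib (firstN Y n) (firstN X n) μ (firstN X n ω)) ≤ B) := by
  refine ae_all_iff.2 fun i => ae_all_iff.2 fun j => ?_
  have hL2 := memLp_response_sub hm hident hm_reg hY2
  have hY_int : Integrable (Y 0) μ := hY2.integrable one_le_two
  have hint2 : ∀ i j, Integrable (fun ω => (Y i ω - m (X i ω)) * (Y j ω - m (X j ω))) μ :=
    fun i j => (hL2 i).integrable_mul (hL2 j)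
  have hφm : Measurable (Function.uncurry fun (u v : Fin n → ℝ) =>
      (v i - m (u i)) * (v j - m (u j))) := by
    simp only [Function.uncurry_def]
    fun_prop
  have hi := ae_integrable_condDistrib (measurable_firstN hX n) (measurable_firstN hY n) hφm
    (hint2 i j)
  refine hi.and ?_
  by_cases hij : i = j
  · subst hij
    have hsq : ∀ i, Integrable (fun ω => (Y i ω - m (X i ω)) ^ 2 - B) μ := fun i =>
      (hL2 i).integrable_sq.sub (integrable_const B)
    have hφm' : Measurable (Function.uncurry fun (u v : Fin n → ℝ) => (v i - m (u i)) ^ 2 - B) := by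
      simp only [Function.uncurry_def]
      fun_prop
    filter_upwards [hi, ae_condMeanGiven_nonpos (measurable_firstN hX n) (measurable_firstN hY n)
      hφm' (hsq i) fun A hA => by
        have h1 := setIntegral_firstN_nonpos hX hY hindep hident i
          (φ := fun p => (p.2 - m p.1) ^ 2 - B) (by fun_prop) (hsq 0) (w := fun _ => 1)
          measurable_const (integrable_const _)
          (fun _ S hS => by
            rw [one_mul]; exact setIntegral_sq_response_sub hX hm_reg hY2 hvar hS) hA
        simpa only [one_mul, firstN] using h1] with ω h1 h2
    refine ⟨fun h => absurd rfl h, fun _ => ?_⟩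
    simp only [condMeanGiven, ← sq, firstN] at h1 h2 ⊢
    rw [integral_sub h1 (integrable_const _)] at h2
    simp only [integral_const, probReal_univ, one_smul] at h2
    linarith
  · have hjmem : (j : ℕ) ∈ (Finset.range n).erase i :=
      Finset.mem_erase.2 ⟨fun h => hij (Fin.ext h.symm), Finset.mem_range.2 j.2⟩
    have h1 := fun (c : ℝ) A hA => setIntegral_firstN_nonpos hX hY hindep hident i
      (φ := fun p => p.2 - m p.1)
      (by fun_prop) (integrable_response_sub hm hY_int hident hm_reg 0)
      (w := fun t => c * ((t ⟨j, hjmem⟩).2 - m (t ⟨j, hjmem⟩).1)) (by fun_prop)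
      ((integrable_response_sub hm hY_int hident hm_reg j).const_mul c)
      (fun _ S hS => by rw [setIntegral_response_sub hX hY_int hm_reg hS, mul_zero]) (A := A) hA
    filter_upwards [ae_condMeanGiven_eq_zero (measurable_firstN hX n) (measurable_firstN hY n) hφm
      (hint2 i j) fun A hA => le_antisymm (by
        simpa only [one_mul, mul_one, firstN, mul_comm] using h1 1 A hA) (by
        have h2 := h1 (-1) A hA
        simp only [neg_mul, one_mul, integral_neg] at h2
        simpa only [firstN, mul_comm] using neg_nonpos.1 h2)] with ω h2
    exact ⟨fun _ => h2, fun h => absurd h hij⟩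

/-- The mean of a linear estimate under the regular conditional distribution. -/
lemma ae_condMeanGiven_boostedNW (hX : ∀ i, Measurable (X i)) (hY : ∀ i, Measurable (Y i))
    (hindep : iIndepFun (fun i ω => (X i ω, Y i ω)) μ)
    (hident : ∀ i, IdentDistrib (fun ω => (X i ω, Y i ω)) (fun ω => (X 0 ω, Y 0 ω)) μ μ)
    (hm : Measurable m) (hY_int : Integrable (Y 0) μ)
    (hm_reg : μ[Y 0 | MeasurableSpace.comap (X 0) inferInstance] =ᵐ[μ] fun ω => m (X 0 ω))
    (K : ℝ → ℝ) (h : ℝ) (r n : ℕ) : ∀ᵐ ω ∂μ, ∀ x,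
      condMeanGiven μ (firstN X n) (firstN Y n) (fun xs ys => boostedNW K h xs ys r x) ω =
        boostedNW K h (firstN X n ω) (fun i => m (firstN X n ω i)) r x := by
  filter_upwards [ae_integral_response_sub hX hY hindep hident hm hY_int hm_reg n] with ω hω x
  rw [condMeanGiven]
  simp only [boostedNW_eq_sum]
  have hi : ∀ i : Fin n, Integrable (fun v : Fin n → ℝ => v i)
      (condDistrib (firstN Y n) (firstN X n) μ (firstN X n ω)) := fun i =>
    ((hω i).1.add (integrable_const (m (X i ω)))).congr
      (Eventually.of_forall fun v => sub_add_cancel _ _)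
  rw [integral_finsetSum _ fun i _ => (hi i).const_mul _]
  refine Finset.sum_congr rfl fun i _ => ?_
  rw [integral_const_mul]
  have h1 := (hω i).2
  rw [integral_sub (hi i) (integrable_const _)] at h1
  simp only [integral_const, probReal_univ, one_smul] at h1
  rw [sub_eq_zero.1 h1, firstN]

/-- The second moment of a linear combination of uncorrelated centred variables, plus a constant. -/
lemma integral_sq_sum_add_le {V : Type*} [MeasurableSpace V] {κ : Measure V}
    [IsProbabilityMeasure κ] {n : ℕ} {e : Fin n → V → ℝ} (he : ∀ i, Integrable (e i) κ)
    (he2 : ∀ i j, Integrable (fun v => e i v * e j v) κ) (h0 : ∀ i, ∫ v, e i v ∂κ = 0)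
    {B : ℝ} (hB : ∀ i, ∫ v, e i v * e i v ∂κ ≤ B)
    (h0' : ∀ i j, i ≠ j → ∫ v, e i v * e j v ∂κ = 0) (W : Fin n → ℝ) (b : ℝ) :
    ∫ v, ((∑ i, W i * e i v) + b) ^ 2 ∂κ ≤ B * (∑ i, W i ^ 2) + b ^ 2 := by
  have hexp : ∀ v, ((∑ i, W i * e i v) + b) ^ 2 =
      (∑ i, ∑ j, W i * W j * (e i v * e j v)) + ((2 * b) * (∑ i, W i * e i v) + b ^ 2) := by
    intro v
    have : (∑ i, W i * e i v) ^ 2 = ∑ i, ∑ j, W i * W j * (e i v * e j v) := by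
      rw [sq, Finset.sum_mul_sum]
      exact Finset.sum_congr rfl fun i _ => Finset.sum_congr rfl fun j _ => by ring
    rw [← this]
    ring
  have i1 : Integrable (fun v => ∑ i, ∑ j, W i * W j * (e i v * e j v)) κ :=
    integrable_finsetSum _ fun i _ => integrable_finsetSum _ fun j _ => (he2 i j).const_mul _
  have i2 : Integrable (fun v => ∑ i, W i * e i v) κ :=
    integrable_finsetSum _ fun i _ => (he i).const_mul _
  simp only [hexp]
  rw [integral_add (g := fun v => (2 * b) * (∑ i, W i * e i v) + b ^ 2) i1
      ((i2.const_mul _).add (integrable_const _)),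
    integral_add (i2.const_mul _) (integrable_const _), integral_const_mul,
    integral_finsetSum _ fun i _ => (he i).const_mul _,
    integral_finsetSum _ fun i _ => integrable_finsetSum _ fun j _ => (he2 i j).const_mul _]
  simp only [integral_const_mul, h0, mul_zero, Finset.sum_const_zero, integral_const,
    probReal_univ, one_smul, zero_add]
  refine add_le_add ?_ le_rfl
  rw [Finset.mul_sum]
  refine Finset.sum_le_sum fun i _ => ?_
  rw [integral_finsetSum _ fun j _ => (he2 i j).const_mul _,
    Finset.sum_eq_single i (fun j _ hj => by
      rw [integral_const_mul, h0' i j hj.symm, mul_zero]) (by simp), integral_const_mul]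
  rw [sq, mul_comm B]
  exact mul_le_mul_of_nonneg_left (hB i) (mul_self_nonneg _)

/-- The bias-variance bound for the conditional mean squared error of the boosted smoother. -/
lemma ae_condMeanGiven_sq_le (hX : ∀ i, Measurable (X i)) (hY : ∀ i, Measurable (Y i))
    (hindep : iIndepFun (fun i ω => (X i ω, Y i ω)) μ)
    (hident : ∀ i, IdentDistrib (fun ω => (X i ω, Y i ω)) (fun ω => (X 0 ω, Y 0 ω)) μ μ)
    (hm : Measurable m)
    (hm_reg : μ[Y 0 | MeasurableSpace.comap (X 0) inferInstance] =ᵐ[μ] fun ω => m (X 0 ω))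
    {B : ℝ} (hY2 : MemLp (Y 0) 2 μ)
    (hvar : ∀ᵐ ω ∂μ, condVar (MeasurableSpace.comap (X 0) inferInstance) (Y 0) μ ω ≤ B)
    (K : ℝ → ℝ) (h : ℝ) (r n : ℕ) : ∀ᵐ ω ∂μ, ∀ x a,
      condMeanGiven μ (firstN X n) (firstN Y n) (fun xs ys => (boostedNW K h xs ys r x - a) ^ 2) ω ≤
        B * (∑ i, boostWeight K h (firstN X n ω) r x i ^ 2) +
          (boostedNW K h (firstN X n ω) (fun i => m (firstN X n ω i)) r x - a) ^ 2 := by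
  filter_upwards [ae_integral_response_sub hX hY hindep hident hm (hY2.integrable one_le_two)
    hm_reg n, ae_integral_mul_response_sub hX hY hindep hident hm hm_reg hY2 hvar n]
    with ω h1 h2 x a
  have h3 := integral_sq_sum_add_le (e := fun (i : Fin n) (v : Fin n → ℝ) => v i - m (X i ω))
    (fun i => (h1 i).1) (fun i j => (h2 i j).1) (fun i => (h1 i).2)
    (fun i => (h2 i i).2.2 rfl) (fun i j => (h2 i j).2.1)
    (boostWeight K h (firstN X n ω) r x)
    (boostedNW K h (firstN X n ω) (fun i => m (firstN X n ω i)) r x - a)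
  refine le_trans (le_of_eq ?_) h3
  rw [condMeanGiven]
  congr 1 with v
  congr 1
  simp only [boostedNW_eq_sum, mul_sub, Finset.sum_sub_distrib, firstN]
  ring

end Iid

end Conditional

/-! ### The empirical smoother at the population residuals -/

/-- The properties of the design density which enter the estimates: it is measurable, takes values
in `[0, A]`, and stays above `c > 0` on `[0, 1]`. -/
structure IsDesignDensity (f : ℝ → ℝ) (c A : ℝ) : Prop where
  measurable : Measurable f
  nonneg : ∀ u, 0 ≤ f u
  le : ∀ u, f u ≤ A
  pos : 0 < c
  low : ∀ u ∈ Icc (0 : ℝ) 1, c ≤ f u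

namespace IsDesignDensity

variable {K f g : ℝ → ℝ} {c A h : ℝ}

lemma abs_le (hf : IsDesignDensity f c A) (u : ℝ) : |f u| ≤ A := by
  rw [abs_of_nonneg (hf.nonneg u)]; exact hf.le u

lemma A_pos (hf : IsDesignDensity f c A) : 0 < A :=
  hf.pos.trans_le ((hf.low 0 (by simp)).trans (hf.le 0))

lemma le_integral (hf : IsDesignDensity f c A) (hK : IsSmoothingKernel K) (hh : 0 < h) {x : ℝ}
    (hx : x ∈ Icc h (1 - h)) : c ≤ ∫ t, K t * f (x + h * t) := by
  have := hf.measurable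
  refine hK.le_integral_mul (by fun_prop) (B := A) (fun t _ => hf.abs_le _) fun t ht => hf.low _ ?_
  have h1 := _root_.abs_le.1 ht
  constructor <;> nlinarith [hx.1, hx.2]

lemma integral_le (hf : IsDesignDensity f c A) (hK : IsSmoothingKernel K) (x : ℝ) :
    ∫ t, K t * f (x + h * t) ≤ A :=
  (le_abs_self _).trans (hK.abs_integral_mul_le fun _ _ => hf.abs_le _)

/-- The iterated population residuals of a Lipschitz function vary by `O(h)` at distance `h`. -/
lemma abs_iterate_popResidual_sub_le (hf : IsDesignDensity f c A) (hK : IsSmoothingKernel K)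
    (hh : 0 < h) {a b M L : ℝ} (ha : h ≤ a) (hb : b ≤ 1 - h) (hg : Measurable g)
    (hM : ∀ u, |g u| ≤ M)
    (hL : ∀ u ∈ Icc a b, ∀ v ∈ Icc a b, |g u - g v| ≤ L * |u - v|) (hL0 : 0 ≤ L) (j : ℕ) :
    ∀ x ∈ Icc (a + (j + 1 : ℕ) * h) (b - (j + 1 : ℕ) * h), ∀ u, |u - x| ≤ h →
      |(popResidual K h f)^[j] g u - (popResidual K h f)^[j] g x| ≤ 2 ^ j * (L * h) := by
  induction j with
  | zero =>
    intro x hx u hu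
    have h1 := Icc_window_subset hh a b 0 (mem_Icc_of_abs_sub_le hx hu)
    have h2 := Icc_window_subset hh a b _ hx
    simp only [Function.iterate_zero, id_eq, pow_zero, one_mul]
    exact (hL _ h1 _ h2).trans (mul_le_mul_of_nonneg_left hu hL0)
  | succ j ih =>
    have key : ∀ x ∈ Icc (a + (j + 1 : ℕ) * h) (b - (j + 1 : ℕ) * h),
        |(popResidual K h f)^[j + 1] g x| ≤ 2 ^ j * (L * h) := by
      intro x hx
      have hx' := Icc_window_subset hh a b _ hx
      rw [Function.iterate_succ_apply', popResidual, abs_sub_comm]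
      refine abs_localAvg_sub_le hK hf.measurable hf.nonneg hf.le
        (measurable_iterate_popResidual hK hf.measurable hg h j)
        (abs_iterate_popResidual_le hK hf.measurable hf.nonneg hf.le hg hM h j)
        (hf.pos.trans_le (hf.le_integral hK hh ⟨ha.trans hx'.1, hx'.2.trans hb⟩))
        fun t ht => ih x hx _ ?_
      rw [add_sub_cancel_left, abs_mul, abs_of_pos hh]
      exact mul_le_of_le_one_right hh.le ht
    intro x hx u hu
    have h1 := key u (mem_Icc_of_abs_sub_le hx hu)
    have h2 := key x (mem_Icc_of_abs_sub_le hx (by simpa using hh.le))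
    refine (abs_sub _ _).trans ?_
    rw [pow_succ]
    linarith

end IsDesignDensity

section Events

variable {Ω : Type*} [MeasurableSpace Ω] {μ : Measure Ω} [IsProbabilityMeasure μ]
  {K f : ℝ → ℝ} {c A : ℝ}

omit [IsProbabilityMeasure μ] in
/-- Kernel-weighted means of functions of the covariate, in the variable `t = (u - x) / h`. -/
lemma integral_scaledKernel_mul (hf : IsDesignDensity f c A) {X : Ω → ℝ} (hX : Measurable X)
    (hpdf : μ.map X = volume.withDensity (fun x => ENNReal.ofReal (f x)))
    (hK : IsSmoothingKernel K) {h : ℝ} (hh : 0 < h) {φ : ℝ → ℝ} (hφ : Measurable φ) (x : ℝ) :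
    ∫ ω, scaledKernel K h (X ω - x) * φ (X ω) ∂μ =
      ∫ t, K t * (f (x + h * t) * φ (x + h * t)) := by
  have hKm := hK.measurable
  have hfm := hf.measurable
  have h1 : ∫ ω, scaledKernel K h (X ω - x) * φ (X ω) ∂μ =
      ∫ u, scaledKernel K h (u - x) * φ u ∂(μ.map X) := by
    rw [integral_map hX.aemeasurable]
    unfold scaledKernel
    exact Measurable.aestronglyMeasurable (by fun_prop)
  rw [h1, hpdf, integral_withDensity_eq_integral_toReal_smul (by fun_prop)
    (Eventually.of_forall fun _ => ENNReal.ofReal_lt_top)]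
  have h2 := Measure.integral_comp_mul_left
    (fun s => (ENNReal.ofReal (f (x + s))).toReal • (scaledKernel K h (x + s - x) * φ (x + s))) h
  have h3 := integral_add_left_eq_self (μ := volume)
    (fun u => (ENNReal.ofReal (f u)).toReal • (scaledKernel K h (u - x) * φ u)) x
  rw [← h3, ← inv_smul_smul₀ (inv_ne_zero hh.ne')
    (∫ s, (ENNReal.ofReal (f (x + s))).toReal • (scaledKernel K h (x + s - x) * φ (x + s))),
    ← abs_of_pos (inv_pos.2 hh), ← h2, abs_of_pos (inv_pos.2 hh), inv_inv, ← integral_smul]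
  congr 1 with t
  rw [ENNReal.toReal_ofReal (hf.nonneg _), scaledKernel, add_sub_cancel_left,
    mul_div_cancel_left₀ _ hh.ne', smul_eq_mul, smul_eq_mul]
  field_simp

lemma abs_scaledKernel_sub_le {κ h : ℝ} (hh : 0 < h)
    (hκ : ∀ u v, |K u - K v| ≤ κ * |u - v|) (u v : ℝ) :
    |scaledKernel K h u - scaledKernel K h v| ≤ κ * |u - v| / h ^ 2 := by
  rw [scaledKernel, scaledKernel, ← sub_div, abs_div, abs_of_pos hh, div_le_iff₀ hh]
  refine (hκ _ _).trans (le_of_eq ?_)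
  rw [← sub_div, abs_div, abs_of_pos hh]
  field_simp

lemma measurable_scaledKernel (hK : IsSmoothingKernel K) (h : ℝ) :
    Measurable (scaledKernel K h) := by
  have := hK.measurable
  unfold scaledKernel
  fun_prop

omit [IsProbabilityMeasure μ] in
/-- The second moment of `K_h (X - x) φ(X)` is of order `b ^ 2 / h` if `φ` is bounded by `b` within
distance `h` of `x`. -/
lemma integral_scaledKernel_mul_sq_le (hf : IsDesignDensity f c A) {X : Ω → ℝ} (hX : Measurable X)
    (hpdf : μ.map X = volume.withDensity (fun x => ENNReal.ofReal (f x)))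
    (hK : IsSmoothingKernel K) {κ : ℝ} (hκ : ∀ u, K u ≤ κ) {h : ℝ} (hh : 0 < h) {φ : ℝ → ℝ}
    (hφ : Measurable φ) {x b : ℝ} (hb : ∀ u, |u - x| ≤ h → |φ u| ≤ b) :
    ∫ ω, (scaledKernel K h (X ω - x) * φ (X ω)) ^ 2 ∂μ ≤ κ * A * b ^ 2 / h := by
  have hA := hf.A_pos
  have hKm := measurable_scaledKernel hK h
  have hκ0 : 0 ≤ κ := (hK.nonneg 0).trans (hκ 0)
  have h1 := integral_scaledKernel_mul hf hX hpdf hK hh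
    (φ := fun u => scaledKernel K h (u - x) * φ u ^ 2) (by fun_prop) x
  have h2 : ∀ ω, (scaledKernel K h (X ω - x) * φ (X ω)) ^ 2 =
      scaledKernel K h (X ω - x) * (scaledKernel K h (X ω - x) * φ (X ω) ^ 2) := fun ω => by ring
  simp only [h2]
  rw [h1]
  refine (le_abs_self _).trans (hK.abs_integral_mul_le fun t ht => ?_)
  have h3 : |x + h * t - x| ≤ h := by
    rw [add_sub_cancel_left, abs_mul, abs_of_pos hh]
    exact mul_le_of_le_one_right hh.le ht
  have h4 : scaledKernel K h (x + h * t - x) ≤ κ / h := div_le_div_of_nonneg_right (hκ _) hh.le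
  rw [abs_mul, abs_mul, abs_of_nonneg (scaledKernel_nonneg hK hh _), abs_pow]
  calc _ ≤ A * (κ / h * b ^ 2) := by
        refine mul_le_mul (hf.abs_le _) ?_ ?_ hA.le
        · exact mul_le_mul h4 (pow_le_pow_left₀ (abs_nonneg _) (hb _ h3) 2) (by positivity)
            (by positivity)
        · exact mul_nonneg (scaledKernel_nonneg hK hh _) (by positivity)
    _ = _ := by ring

/-- Kernel-weighted population means are Lipschitz in the location, with a constant of order
`h ^ (-2)`. -/
lemma abs_integral_kernel_sub_le (hf : IsDesignDensity f c A) {X : Ω → ℝ} (hX : Measurable X)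
    (hpdf : μ.map X = volume.withDensity (fun x => ENNReal.ofReal (f x)))
    (hK : IsSmoothingKernel K) {κ : ℝ} (hκlip : ∀ u v, |K u - K v| ≤ κ * |u - v|)
    {h : ℝ} (hh : 0 < h) {φ : ℝ → ℝ} (hφ : Measurable φ) {B : ℝ} (hB : ∀ u, |φ u| ≤ B) (x x' : ℝ) :
    |(∫ t, K t * (f (x + h * t) * φ (x + h * t))) -
      ∫ t, K t * (f (x' + h * t) * φ (x' + h * t))| ≤ B * (κ * |x - x'| / h ^ 2) := by
  have hKm := measurable_scaledKernel hK h
  obtain ⟨κ', -, hκ', -⟩ := hK.exists_bound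
  have hi : ∀ x, Integrable (fun ω => scaledKernel K h (X ω - x) * φ (X ω)) μ := fun x => by
    refine Integrable.of_bound (C := κ' / h * B)
      (Measurable.aestronglyMeasurable (by fun_prop)) (Eventually.of_forall fun ω => ?_)
    rw [norm_mul, Real.norm_eq_abs, Real.norm_eq_abs,
      abs_of_nonneg (scaledKernel_nonneg hK hh _)]
    refine mul_le_mul (div_le_div_of_nonneg_right (hκ' _) hh.le) (hB _) (abs_nonneg _)
      (div_nonneg ((hK.nonneg 0).trans (hκ' 0)) hh.le)
  rw [← integral_scaledKernel_mul hf hX hpdf hK hh hφ,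
    ← integral_scaledKernel_mul hf hX hpdf hK hh hφ, ← integral_sub (hi x) (hi x')]
  have h1 : ∀ ω, ‖scaledKernel K h (X ω - x) * φ (X ω) - scaledKernel K h (X ω - x') * φ (X ω)‖ ≤
      B * (κ * |x - x'| / h ^ 2) := fun ω => by
    rw [← sub_mul, Real.norm_eq_abs, abs_mul, mul_comm]
    have h2 := abs_scaledKernel_sub_le hh hκlip (X ω - x) (X ω - x')
    rw [sub_sub_sub_cancel_left, abs_sub_comm x' x] at h2
    exact mul_le_mul (hB _) h2 (abs_nonneg _) ((abs_nonneg _).trans (hB 0))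
  simpa using norm_integral_le_of_norm_le_const (μ := μ) (Eventually.of_forall h1)

/-- The population smoother of a bounded function is Lipschitz, with a constant of order
`h ^ (-2)`. -/
lemma abs_localAvg_sub_localAvg_le (hf : IsDesignDensity f c A) {X : Ω → ℝ} (hX : Measurable X)
    (hpdf : μ.map X = volume.withDensity (fun x => ENNReal.ofReal (f x)))
    (hK : IsSmoothingKernel K) {κ : ℝ} (hκlip : ∀ u v, |K u - K v| ≤ κ * |u - v|)
    {h : ℝ} (hh : 0 < h) {g : ℝ → ℝ} (hg : Measurable g) {M : ℝ} (hM : ∀ u, |g u| ≤ M) {x x' : ℝ}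
    (hx : x ∈ Icc h (1 - h)) (hx' : x' ∈ Icc h (1 - h)) :
    |localAvg K h f g x - localAvg K h f g x'| ≤ 2 * M * κ / c * |x - x'| / h ^ 2 := by
  have hc := hf.pos
  have hM0 : 0 ≤ M := (abs_nonneg _).trans (hM 0)
  have hN := abs_integral_kernel_sub_le hf hX hpdf hK hκlip hh hg hM x x'
  have hD := abs_integral_kernel_sub_le hf hX hpdf hK hκlip hh (φ := fun _ => 1) (B := 1)
    measurable_const (fun _ => by simp) x x'
  simp only [mul_one, one_mul] at hD
  have hDx := hf.le_integral hK hh hx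
  have hDx' := hf.le_integral hK hh hx'
  have hl := abs_localAvg_le (h := h) hK hf.measurable hf.nonneg hf.le hg hM x'
  set N := ∫ t, K t * (f (x + h * t) * g (x + h * t)) with hNdef
  set N' := ∫ t, K t * (f (x' + h * t) * g (x' + h * t)) with hNdef'
  set D := ∫ t, K t * f (x + h * t) with hDdef
  set D' := ∫ t, K t * f (x' + h * t) with hDdef'
  set δ := κ * |x - x'| / h ^ 2 with hδ
  have hD0 : 0 < D := hc.trans_le hDx
  have hD0' : 0 < D' := hc.trans_le hDx'
  have hl' : localAvg K h f g x' * D' = N' := by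
    rw [localAvg, ← hNdef', ← hDdef', div_mul_cancel₀ _ hD0'.ne']
  have h1 : localAvg K h f g x - localAvg K h f g x' =
      ((N - N') - localAvg K h f g x' * (D - D')) / D := by
    rw [eq_div_iff hD0.ne', sub_mul, mul_sub, hl', localAvg, ← hNdef, ← hDdef,
      div_mul_cancel₀ _ hD0.ne']
    ring
  rw [h1, abs_div, abs_of_pos hD0]
  have h2 : |N - N' - localAvg K h f g x' * (D - D')| ≤ 2 * M * δ := by
    refine (abs_sub _ _).trans ?_
    rw [abs_mul]
    have := mul_le_mul hl hD (abs_nonneg _) hM0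
    linarith
  have h3 : 0 ≤ 2 * M * δ := (abs_nonneg _).trans h2
  calc _ ≤ 2 * M * δ / c := div_le_div₀ h3 h2 hc hDx
    _ = _ := by rw [hδ]; ring

variable {X : ℕ → Ω → ℝ} {h : ℕ → ℝ}

/-- The kernel density estimate is uniformly close to its mean. -/
lemma exists_tendsto_measure_density (hf : IsDesignDensity f c A) (hX : ∀ i, Measurable (X i))
    (hind : iIndepFun X μ) (hid : ∀ i, IdentDistrib (X i) (X 0) μ μ)
    (hpdf : μ.map (X 0) = volume.withDensity (fun x => ENNReal.ofReal (f x)))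
    (hK : IsSmoothingKernel K) (hh : IsBandwidth h) {a b : ℝ} (ha : 0 < a) (hb : b < 1) :
    ∃ M, 0 ≤ M ∧ Tendsto (fun n : ℕ => μ {ω | ∃ x ∈ Icc a b, M * √(h n * Real.log n / n) <
      |(∑ i : Fin n, h n * (scaledKernel K (h n) (X i ω - x) -
        ∫ t, K t * f (x + h n * t))) / n|}) atTop (𝓝 0) := by
  obtain ⟨κ, hκ0, hκ, hκlip⟩ := hK.exists_bound
  have hA := hf.A_pos
  refine exists_tendsto_measure_sup_average hX hind hid hh
    (fun n x ξ => h n * (scaledKernel K (h n) (ξ - x) - ∫ t, K t * f (x + h n * t)))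
    (fun _ => Icc a b) (fun _ => Icc_subset_Icc ha.le hb.le)
    (B := κ + A + 2 * κ * A + 2 * A ^ 2 + 2 * κ) (by positivity) ?_ ?_
  · filter_upwards [hh.zero.eventually_le_const one_pos, hh.zero.eventually_le_const ha,
      hh.zero.eventually_le_const (sub_pos.2 hb)] with n h1 ha' hb' x hx
    have hη := hh.pos n
    set η := h n
    set D := ∫ t, K t * f (x + η * t) with hD
    have hDc : c ≤ D := hf.le_integral hK hη ⟨ha'.trans hx.1, by linarith [hx.2]⟩
    have hD0 : 0 < D := hf.pos.trans_le hDc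
    have hDA : D ≤ A := hf.integral_le hK x
    have hKm := measurable_scaledKernel hK η
    have hXm := hX 0
    have hint : Integrable (fun ω => scaledKernel K η (X 0 ω - x)) μ := by
      refine Integrable.of_bound (C := κ / η)
        (Measurable.aestronglyMeasurable (by fun_prop)) (Eventually.of_forall fun ω => ?_)
      rw [Real.norm_eq_abs, abs_of_nonneg (scaledKernel_nonneg hK hη _)]
      exact div_le_div_of_nonneg_right (hκ _) hη.le
    have hmean : ∫ ω, scaledKernel K η (X 0 ω - x) ∂μ = D := by
      have := integral_scaledKernel_mul hf (hX 0) hpdf hK hη (φ := fun _ => 1) measurable_const x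
      simpa using this
    have hsq : ∫ ω, scaledKernel K η (X 0 ω - x) ^ 2 ∂μ ≤ κ * A / η := by
      have := integral_scaledKernel_mul_sq_le hf (hX 0) hpdf hK hκ hη (φ := fun _ => 1)
        measurable_const (x := x) (b := 1) (fun _ _ => by simp)
      simpa using this
    have hsqint : Integrable (fun ω => scaledKernel K η (X 0 ω - x) ^ 2) μ := by
      refine Integrable.of_bound (C := (κ / η) ^ 2)
        (Measurable.aestronglyMeasurable (by fun_prop)) (Eventually.of_forall fun ω => ?_)
      rw [Real.norm_eq_abs, abs_pow, abs_of_nonneg (scaledKernel_nonneg hK hη _)]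
      exact pow_le_pow_left₀ (scaledKernel_nonneg hK hη _)
        (div_le_div_of_nonneg_right (hκ _) hη.le) 2
    refine ⟨by fun_prop, fun ξ => ?_, ?_, ?_⟩
    · have e1 : η * scaledKernel K η (ξ - x) ≤ κ := by
        rw [scaledKernel, mul_div_cancel₀ _ hη.ne']
        exact hκ _
      have e2 : 0 ≤ η * scaledKernel K η (ξ - x) :=
        mul_nonneg hη.le (scaledKernel_nonneg hK hη _)
      have e3 : η * D ≤ A := (mul_le_of_le_one_left hD0.le h1).trans hDA
      have e4 : 0 ≤ η * D := by positivity
      have e5 : 0 ≤ 2 * κ * A + 2 * A ^ 2 + 2 * κ := by positivity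
      rw [mul_sub, _root_.abs_le]
      constructor <;> linarith
    · rw [integral_const_mul, integral_sub hint (integrable_const _), hmean]
      simp
    · calc ∫ ω, (η * (scaledKernel K η (X 0 ω - x) - D)) ^ 2 ∂μ
          ≤ ∫ ω, η ^ 2 * (2 * scaledKernel K η (X 0 ω - x) ^ 2 + 2 * D ^ 2) ∂μ := by
            refine integral_mono_of_nonneg (Eventually.of_forall fun ω => sq_nonneg _)
              (((hsqint.const_mul 2).add (integrable_const _)).const_mul _)
              (Eventually.of_forall fun ω => ?_)
            simp only [mul_pow]
            refine mul_le_mul_of_nonneg_left ?_ (sq_nonneg η)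
            nlinarith [sq_nonneg (scaledKernel K η (X 0 ω - x) + D)]
        _ = η ^ 2 * (2 * (∫ ω, scaledKernel K η (X 0 ω - x) ^ 2 ∂μ) + 2 * D ^ 2) := by
            rw [integral_const_mul, integral_add (hsqint.const_mul 2) (integrable_const _),
              integral_const_mul]
            simp
        _ ≤ η ^ 2 * (2 * (κ * A / η) + 2 * A ^ 2) := by
            have : D ^ 2 ≤ A ^ 2 := pow_le_pow_left₀ hD0.le hDA 2
            gcongr
        _ = 2 * κ * A * η + 2 * A ^ 2 * η * η := by
            field_simp
        _ ≤ 2 * κ * A * η + 2 * A ^ 2 * η * 1 := by gcongr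
        _ ≤ _ := by
            have : 0 ≤ (κ + A + 2 * κ) * η := by positivity
            linarith
  · filter_upwards [hh.zero.eventually_le_const one_pos] with n h1 x hx x' hx' ξ
    have hη := hh.pos n
    set η := h n
    have e1 := abs_scaledKernel_sub_le hη hκlip (ξ - x) (ξ - x')
    rw [sub_sub_sub_cancel_left, abs_sub_comm x' x] at e1
    have hD := abs_integral_kernel_sub_le hf (hX 0) hpdf hK hκlip hη (φ := fun _ => 1) (B := 1)
      measurable_const (fun _ => by simp) x x'
    simp only [mul_one, one_mul] at hD
    set δ := κ * |x - x'| / η ^ 2 with hδ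
    have hδ0 : 0 ≤ δ := by positivity
    rw [← mul_sub, abs_mul, abs_of_pos hη]
    calc η * |scaledKernel K η (ξ - x) - (∫ t, K t * f (x + η * t)) -
          (scaledKernel K η (ξ - x') - ∫ t, K t * f (x' + η * t))| ≤ 1 * (2 * δ) := by
          refine mul_le_mul h1 ?_ (abs_nonneg _) zero_le_one
          rw [_root_.abs_le] at e1 hD ⊢
          constructor <;> linarith
      _ = 2 * κ * |x - x'| / η ^ 2 := by rw [hδ]; ring
      _ ≤ 2 * κ * |x - x'| / η ^ 3 := by
          refine div_le_div_of_nonneg_left (by positivity) (by positivity) ?_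
          exact pow_le_pow_of_le_one hη.le h1 (by norm_num)
      _ ≤ _ := by
          refine div_le_div_of_nonneg_right ?_ (by positivity)
          refine mul_le_mul_of_nonneg_right ?_ (abs_nonneg _)
          have : 0 ≤ κ + A + 2 * κ * A + 2 * A ^ 2 := by positivity
          linarith

/-- The numerator of `Ŝ g - S g`, for `g` an iterated population residual of a Lipschitz function,
is uniformly `O(√(h log n / n))`: centring at `S g` makes the summands `O(1)` instead of
`O(1 / h)`. -/
lemma exists_tendsto_measure_numerator (hf : IsDesignDensity f c A) (hX : ∀ i, Measurable (X i))
    (hind : iIndepFun X μ) (hid : ∀ i, IdentDistrib (X i) (X 0) μ μ)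
    (hpdf : μ.map (X 0) = volume.withDensity (fun x => ENNReal.ofReal (f x)))
    (hK : IsSmoothingKernel K) (hh : IsBandwidth h) {a b : ℝ} (ha : 0 < a) (hb : b < 1)
    {g : ℝ → ℝ} (hg : Measurable g) {M L : ℝ} (hM : ∀ u, |g u| ≤ M)
    (hL : ∀ u ∈ Icc a b, ∀ v ∈ Icc a b, |g u - g v| ≤ L * |u - v|) (hL0 : 0 ≤ L) (j : ℕ) :
    ∃ M', 0 ≤ M' ∧ Tendsto (fun n : ℕ => μ {ω |
      ∃ x ∈ Icc (a + (j + 1 : ℕ) * h n) (b - (j + 1 : ℕ) * h n),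
      M' * √(h n * Real.log n / n) < |(∑ i : Fin n, scaledKernel K (h n) (X i ω - x) *
        ((popResidual K (h n) f)^[j] g (X i ω) -
          localAvg K (h n) f ((popResidual K (h n) f)^[j] g) x)) / n|}) atTop (𝓝 0) := by
  obtain ⟨κ, hκ0, hκ, hκlip⟩ := hK.exists_bound
  have hA := hf.A_pos
  have hc := hf.pos
  have hM0 : 0 ≤ M := (abs_nonneg _).trans (hM 0)
  set L' := 2 * (2 ^ j * L) with hL'
  have hL'0 : 0 ≤ L' := by positivity
  set M' := 2 ^ j * M with hM'
  have hM'0 : 0 ≤ M' := by positivity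
  refine exists_tendsto_measure_sup_average hX hind hid hh
    (fun n x ξ => scaledKernel K (h n) (ξ - x) * ((popResidual K (h n) f)^[j] g ξ -
          localAvg K (h n) f ((popResidual K (h n) f)^[j] g) x))
    (fun n => Icc (a + (j + 1 : ℕ) * h n) (b - (j + 1 : ℕ) * h n))
    (fun n => (Icc_window_subset (hh.pos n) a b _).trans (Icc_subset_Icc ha.le hb.le))
    (B := κ * L' + κ * A * L' ^ 2 + 2 * M' * κ + κ * (2 * M' * κ / c)) (by positivity) ?_ ?_
  · filter_upwards [hh.zero.eventually_le_const ha,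
      hh.zero.eventually_le_const (sub_pos.2 hb)] with n ha' hb' x hx
    have hη := hh.pos n
    set η := h n
    set gj := (popResidual K η f)^[j] g with hgj
    have hgm : Measurable gj := measurable_iterate_popResidual hK hf.measurable hg η j
    have hgM : ∀ u, |gj u| ≤ M' :=
      abs_iterate_popResidual_le hK hf.measurable hf.nonneg hf.le hg hM η j
    have hx' := Icc_window_subset hη a b _ hx
    have hDc := hf.le_integral hK hη (x := x) ⟨ha'.trans hx'.1, by linarith [hx'.2]⟩
    have hosc : ∀ u, |u - x| ≤ η → |gj u - gj x| ≤ 2 ^ j * (L * η) :=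
      hf.abs_iterate_popResidual_sub_le hK hη ha' (by linarith) hg hM hL hL0 j x hx
    have hav : |localAvg K η f gj x - gj x| ≤ 2 ^ j * (L * η) :=
      abs_localAvg_sub_le hK hf.measurable hf.nonneg hf.le hgm hgM (hc.trans_le hDc)
        fun t ht => hosc _ (by
          rw [add_sub_cancel_left, abs_mul, abs_of_pos hη]
          exact mul_le_of_le_one_right hη.le ht)
    have hdev : ∀ u, |u - x| ≤ η → |gj u - localAvg K η f gj x| ≤ L' * η := fun u hu => by
      have h1 := hosc u hu
      rw [_root_.abs_le] at h1 hav ⊢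
      constructor <;> (rw [hL']; linarith)
    have hKm := measurable_scaledKernel hK η
    have hB' : κ * L' ≤ κ * L' + κ * A * L' ^ 2 + 2 * M' * κ + κ * (2 * M' * κ / c) := by
      have : 0 ≤ κ * A * L' ^ 2 + 2 * M' * κ + κ * (2 * M' * κ / c) := by positivity
      linarith
    refine ⟨by fun_prop, fun ξ => ?_, ?_, ?_⟩
    · refine le_trans ?_ hB'
      rw [abs_mul, abs_of_nonneg (scaledKernel_nonneg hK hη _)]
      by_cases hz : scaledKernel K η (ξ - x) = 0
      · rw [hz, zero_mul]; positivity
      · calc _ ≤ (κ / η) * (L' * η) :=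
              mul_le_mul (div_le_div_of_nonneg_right (hκ _) hη.le)
                (hdev ξ (abs_le_of_scaledKernel_ne_zero hK hη hz)) (abs_nonneg _) (by positivity)
          _ = κ * L' := by field_simp
    · rw [integral_scaledKernel_mul hf (hX 0) hpdf hK hη
        (φ := fun u => gj u - localAvg K η f gj x) (by fun_prop) x]
      have hfm := hf.measurable
      have i1 : Integrable fun t => K t * f (x + η * t) :=
        hK.integrable_mul (by fun_prop) (B := A) (fun t _ => hf.abs_le _)
      have i2 : Integrable fun t => K t * (f (x + η * t) * gj (x + η * t)) :=
        hK.integrable_mul (by fun_prop) (B := A * M') (fun t _ => by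
          rw [abs_mul]
          exact mul_le_mul (hf.abs_le _) (hgM _) (abs_nonneg _) hA.le)
      have e1 : ∀ t, K t * (f (x + η * t) * (gj (x + η * t) - localAvg K η f gj x)) =
          K t * (f (x + η * t) * gj (x + η * t)) -
            K t * f (x + η * t) * localAvg K η f gj x := fun t => by ring
      simp only [e1]
      rw [integral_sub i2 (i1.mul_const _), integral_mul_const, localAvg,
        mul_div_cancel₀ _ (hc.trans_le hDc).ne', sub_self]
    · refine (integral_scaledKernel_mul_sq_le hf (hX 0) hpdf hK hκ hη
        (φ := fun u => gj u - localAvg K η f gj x) (by fun_prop) (b := L' * η) hdev).trans ?_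
      have e1 : κ * A * (L' * η) ^ 2 / η = κ * A * L' ^ 2 * η := by field_simp
      rw [e1]
      refine mul_le_mul_of_nonneg_right ?_ hη.le
      have : 0 ≤ κ * L' + 2 * M' * κ + κ * (2 * M' * κ / c) := by positivity
      linarith
  · filter_upwards [hh.zero.eventually_le_const one_pos, hh.zero.eventually_le_const ha,
      hh.zero.eventually_le_const (sub_pos.2 hb)] with n h1 ha' hb' x hx x' hx' ξ
    have hη := hh.pos n
    set η := h n
    set gj := (popResidual K η f)^[j] g with hgj
    have hgm : Measurable gj := measurable_iterate_popResidual hK hf.measurable hg η j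
    have hgM : ∀ u, |gj u| ≤ M' :=
      abs_iterate_popResidual_le hK hf.measurable hf.nonneg hf.le hg hM η j
    have hmem : ∀ x ∈ Icc (a + (j + 1 : ℕ) * η) (b - (j + 1 : ℕ) * η), x ∈ Icc η (1 - η) :=
      fun x hx => by
        have := Icc_window_subset hη a b _ hx
        exact ⟨ha'.trans this.1, by linarith [this.2]⟩
    have e1 := abs_scaledKernel_sub_le hη hκlip (ξ - x) (ξ - x')
    rw [sub_sub_sub_cancel_left, abs_sub_comm x' x] at e1
    have e2 := abs_localAvg_sub_localAvg_le hf (hX 0) hpdf hK hκlip hη hgm hgM (hmem x hx)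
      (hmem x' hx')
    have e3 : |gj ξ - localAvg K η f gj x| ≤ 2 * M' := by
      refine (abs_sub _ _).trans ?_
      have := abs_localAvg_le (h := η) hK hf.measurable hf.nonneg hf.le hgm hgM x
      linarith [hgM ξ]
    have e4 : |scaledKernel K η (ξ - x')| ≤ κ / η := by
      rw [abs_of_nonneg (scaledKernel_nonneg hK hη _)]
      exact div_le_div_of_nonneg_right (hκ _) hη.le
    have e5 : scaledKernel K η (ξ - x) * (gj ξ - localAvg K η f gj x) -
        scaledKernel K η (ξ - x') * (gj ξ - localAvg K η f gj x') =
        (scaledKernel K η (ξ - x) - scaledKernel K η (ξ - x')) * (gj ξ - localAvg K η f gj x) -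
          scaledKernel K η (ξ - x') * (localAvg K η f gj x - localAvg K η f gj x') := by ring
    rw [e5]
    refine (abs_sub _ _).trans ?_
    rw [abs_mul, abs_mul]
    calc _ ≤ (κ * |x - x'| / η ^ 2) * (2 * M') +
          (κ / η) * (2 * M' * κ / c * |x - x'| / η ^ 2) := by
          gcongr
      _ = (2 * M' * κ * η + κ * (2 * M' * κ / c)) * |x - x'| / η ^ 3 := by
          field_simp
      _ ≤ _ := by
          refine div_le_div_of_nonneg_right ?_ (by positivity)
          refine mul_le_mul_of_nonneg_right ?_ (abs_nonneg _)
          have e6 : 2 * M' * κ * η ≤ 2 * M' * κ := mul_le_of_le_one_right (by positivity) h1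
          have : 0 ≤ κ * L' + κ * A * L' ^ 2 := by positivity
          linarith

/-- With probability tending to one, the empirical smoother has weights of order `1 / (n h)` and
is uniformly within `O(√(h log n / n))` of the population smoother at the first `k` iterated
population residuals. -/
theorem exists_good_event (hf : IsDesignDensity f c A) (hX : ∀ i, Measurable (X i))
    (hind : iIndepFun X μ) (hid : ∀ i, IdentDistrib (X i) (X 0) μ μ)
    (hpdf : μ.map (X 0) = volume.withDensity (fun x => ENNReal.ofReal (f x)))
    (hK : IsSmoothingKernel K) (hh : IsBandwidth h) {a b : ℝ} (ha : 0 < a) (hb : b < 1)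
    {g : ℝ → ℝ} (hg : Measurable g) {M L : ℝ} (hM : ∀ u, |g u| ≤ M)
    (hL : ∀ u ∈ Icc a b, ∀ v ∈ Icc a b, |g u - g v| ≤ L * |u - v|) (hL0 : 0 ≤ L) (k : ℕ) :
    ∃ C, 0 ≤ C ∧ ∃ bad : ℕ → Set Ω, Tendsto (fun n => μ (bad n)) atTop (𝓝 0) ∧
      ∀ᶠ n : ℕ in atTop, ∀ ω ∉ bad n,
        (∀ x ∈ Icc a b, 0 < ∑ i, scaledKernel K (h n) (firstN X n ω i - x)) ∧
        (∀ x ∈ Icc a b, ∀ i, scaledKernel K (h n) (firstN X n ω i - x) /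
          (∑ l, scaledKernel K (h n) (firstN X n ω l - x)) ≤ C * ((n : ℝ)⁻¹ * (h n)⁻¹)) ∧
        ∀ j < k, ∀ x ∈ Icc (a + (j + 1 : ℕ) * h n) (b - (j + 1 : ℕ) * h n),
          |empResidual K (h n) (firstN X n ω) ((popResidual K (h n) f)^[j] g) x -
            popResidual K (h n) f ((popResidual K (h n) f)^[j] g) x| ≤
              C * √(h n * Real.log n / n) := by
  obtain ⟨κ, hκ0, hκ, hκlip⟩ := hK.exists_bound
  have hc := hf.pos
  obtain ⟨M₀, hM₀, hden⟩ := exists_tendsto_measure_density hf hX hind hid hpdf hK hh ha hb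
  choose M₁ hM₁ hnum using
    exists_tendsto_measure_numerator hf hX hind hid hpdf hK hh ha hb hg hM hL hL0
  -- off the bad events the kernel density estimate is at least `c / 2`
  set C := 2 / c * ((∑ j ∈ Finset.range k, M₁ j) + κ) with hC
  have hS0 : 0 ≤ ∑ j ∈ Finset.range k, M₁ j := Finset.sum_nonneg fun j _ => hM₁ j
  refine ⟨C, by positivity, fun n => {ω | ∃ x ∈ Icc a b, M₀ * √(h n * Real.log n / n) <
      |(∑ i : Fin n, h n * (scaledKernel K (h n) (X i ω - x) -
        ∫ t, K t * f (x + h n * t))) / n|} ∪ ⋃ j ∈ Finset.range k, {ω |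
      ∃ x ∈ Icc (a + (j + 1 : ℕ) * h n) (b - (j + 1 : ℕ) * h n),
      M₁ j * √(h n * Real.log n / n) < |(∑ i : Fin n, scaledKernel K (h n) (X i ω - x) *
        ((popResidual K (h n) f)^[j] g (X i ω) -
          localAvg K (h n) f ((popResidual K (h n) f)^[j] g) x)) / n|}, ?_, ?_⟩
  · have h1 := hden.add (tendsto_finsetSum (Finset.range k) fun j _ => hnum j)
    rw [Finset.sum_const_zero, add_zero] at h1
    exact tendsto_of_tendsto_of_tendsto_of_le_of_le tendsto_const_nhds h1 (fun n => zero_le)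
      fun n => (measure_union_le _ _).trans (add_le_add le_rfl (measure_biUnion_finset_le _ _))
  have hsmall : ∀ᶠ n : ℕ in atTop, M₀ * √(Real.log n / (n * h n)) ≤ c / 2 := by
    have := hh.tendsto_sqrt_log_div.const_mul M₀
    rw [mul_zero] at this
    exact this.eventually_le_const (by positivity)
  filter_upwards [hsmall, hh.zero.eventually_le_const ha,
      hh.zero.eventually_le_const (sub_pos.2 hb), eventually_ge_atTop 1]
      with n hsmall ha' hb' hn ω hω
  simp only [mem_union, mem_iUnion, not_or, mem_ofPred_eq, Finset.mem_range, not_exists, not_and,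
    not_lt] at hω
  obtain ⟨hω1, hω2⟩ := hω
  have hn0 : (0 : ℝ) < n := by exact_mod_cast hn
  have hη := hh.pos n
  set η := h n
  have hDen : ∀ x ∈ Icc a b, n * (c / 2) ≤ ∑ i, scaledKernel K η (firstN X n ω i - x) := by
    intro x hx
    have h1 := hω1 x hx
    have hDc := hf.le_integral hK hη (x := x) ⟨ha'.trans hx.1, by linarith [hx.2]⟩
    have e1 : √(η * Real.log n / n) = η * √(Real.log n / (n * η)) := by
      rw [← Real.sqrt_sq hη.le, ← Real.sqrt_mul (sq_nonneg η), Real.sqrt_sq hη.le]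
      congr 1
      field_simp
    rw [← Finset.mul_sum, Finset.sum_sub_distrib, abs_div, abs_of_pos hn0, div_le_iff₀ hn0,
      abs_mul, abs_of_pos hη, e1] at h1
    simp only [Finset.sum_const, Finset.card_univ, Fintype.card_fin, nsmul_eq_mul] at h1
    have h2 : |(∑ i : Fin n, scaledKernel K η (X i ω - x)) - n * ∫ t, K t * f (x + η * t)| ≤
        n * (c / 2) := by
      refine le_of_mul_le_mul_left (h1.trans ?_) hη
      calc _ = η * (n * (M₀ * √(Real.log n / (n * η)))) := by ring
        _ ≤ _ := by gcongr
    have h3 := (_root_.abs_le.1 h2).1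
    have h4 : n * c ≤ n * ∫ t, K t * f (x + η * t) := by gcongr
    simp only [firstN]
    linarith
  have hDen0 : ∀ x ∈ Icc a b, 0 < ∑ i, scaledKernel K η (firstN X n ω i - x) := fun x hx =>
    lt_of_lt_of_le (by positivity) (hDen x hx)
  refine ⟨hDen0, fun x hx i => ?_, fun j hj x hx => ?_⟩
  · calc _ ≤ (κ / η) / (n * (c / 2)) := div_le_div₀ (by positivity)
          (div_le_div_of_nonneg_right (hκ _) hη.le) (by positivity) (hDen x hx)
      _ = 2 / c * κ * ((n : ℝ)⁻¹ * η⁻¹) := by field_simp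
      _ ≤ _ := by
        refine mul_le_mul_of_nonneg_right ?_ (by positivity)
        rw [hC]
        gcongr
        linarith
  · have hx' := Icc_window_subset hη a b _ hx
    have h1 := hω2 j hj x hx
    set gj := (popResidual K η f)^[j] g with hgj
    set ρ := √(η * Real.log n / n)
    rw [abs_div, abs_of_pos hn0, div_le_iff₀ hn0] at h1
    have e1 : empResidual K η (firstN X n ω) gj x - popResidual K η f gj x =
        -((∑ i : Fin n, scaledKernel K η (X i ω - x) * (gj (X i ω) - localAvg K η f gj x)) /
          ∑ i, scaledKernel K η (firstN X n ω i - x)) := by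
      have e2 : (∑ i : Fin n, scaledKernel K η (X i ω - x) * (gj (X i ω) - localAvg K η f gj x)) =
          (∑ i : Fin n, scaledKernel K η (firstN X n ω i - x) * gj (firstN X n ω i)) -
            (∑ i : Fin n, scaledKernel K η (firstN X n ω i - x)) * localAvg K η f gj x := by
        simp only [mul_sub, Finset.sum_sub_distrib, Finset.sum_mul, firstN]
      rw [e2, sub_div, mul_div_cancel_left₀ _ (hDen0 x hx').ne', empResidual, popResidual,
        nadarayaWatson]
      ring
    rw [e1, abs_neg, abs_div, abs_of_pos (hDen0 x hx')]
    have e3 : M₁ j ≤ (∑ j ∈ Finset.range k, M₁ j) + κ :=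
      (Finset.single_le_sum (fun j _ => hM₁ j) (Finset.mem_range.2 hj)).trans (by linarith)
    calc _ ≤ (M₁ j * ρ * n) / (n * (c / 2)) :=
          div_le_div₀ (mul_nonneg (mul_nonneg (hM₁ j) (Real.sqrt_nonneg _)) hn0.le) h1
            (by positivity) (hDen x hx')
      _ = 2 / c * M₁ j * ρ := by field_simp
      _ ≤ C * ρ := by
        rw [hC]
        gcongr

end Events

/-! ### Bias and mean squared error -/

section Assembly

variable {Ω : Type*} [MeasurableSpace Ω] {μ : Measure Ω}

/-- A bound off events of vanishing probability is a bound in probability. The events need not be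
measurable. -/
lemma isBigOpUniformly_of_bad {S : Set ℝ} {Z : ℕ → ℝ → Ω → ℝ} {a : ℕ → ℝ} {C : ℝ}
    {bad : ℕ → Set Ω} (hbad : Tendsto (fun n => μ (bad n)) atTop (𝓝 0))
    (h : ∀ᶠ n in atTop, ∀ᵐ ω ∂μ, ω ∉ bad n → ∀ x ∈ S, |Z n x ω| ≤ C * a n) :
    IsBigOpUniformly μ S Z a := by
  intro η hη
  refine ⟨C, ?_⟩
  filter_upwards [h, hbad.eventually_le_const (ENNReal.ofReal_pos.2 hη)] with n h1 h2
  refine le_trans (measure_mono_ae ?_) h2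
  filter_upwards [h1] with ω h3 h4
  by_contra h5
  obtain ⟨x, hx, hlt⟩ := h4
  exact absurd (h3 h5 x hx) (not_le.2 hlt)

lemma exists_lipschitz_of_holderClass {ν C : ℝ} (hν : 2 ≤ ν) {g : ℝ → ℝ}
    (hg : g ∈ HolderClass ν C) : ∃ L, 0 ≤ L ∧ ∀ u ∈ Icc (0 : ℝ) 1, ∀ v ∈ Icc (0 : ℝ) 1,
      |g u - g v| ≤ L * |u - v| := by
  have h1 : 1 ≤ strictFloor ν := by
    have h2 : 1 < ⌈ν⌉₊ := Nat.lt_ceil.2 (by push_cast; linarith)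
    rw [strictFloor]
    omega
  have hcd : ContDiffOn ℝ 1 g (Icc 0 1) := hg.1.of_le (by exact_mod_cast h1)
  obtain ⟨L, hL⟩ := isCompact_Icc.exists_bound_of_continuousOn
    (hcd.continuousOn_derivWithin (uniqueDiffOn_Icc zero_lt_one) le_rfl)
  refine ⟨max L 0, le_max_right _ _, fun u hu v hv => ?_⟩
  exact (convex_Icc (0 : ℝ) 1).norm_image_sub_le_of_norm_derivWithin_le
    (hcd.differentiableOn one_ne_zero) (fun x hx => (hL x hx).trans (le_max_left _ _)) hv hu

lemma measurable_indicator_of_holderClass {s C : ℝ} {g : ℝ → ℝ} (hg : g ∈ HolderClass s C) :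
    Measurable ((Icc (0 : ℝ) 1).indicator g) := by
  classical
  rw [← piecewise_eq_indicator]
  exact hg.1.continuousOn.measurable_piecewise continuousOn_const measurableSet_Icc

lemma exists_bound_indicator_of_holderClass {s C : ℝ} {g : ℝ → ℝ} (hg : g ∈ HolderClass s C) :
    ∃ M, ∀ u, |(Icc (0 : ℝ) 1).indicator g u| ≤ M := by
  obtain ⟨M, hM⟩ := isCompact_Icc.exists_bound_of_continuousOn hg.1.continuousOn
  refine ⟨M, fun u => ?_⟩
  by_cases hu : u ∈ Icc (0 : ℝ) 1
  · rw [indicator_of_mem hu]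
    exact hM u hu
  · rw [indicator_of_notMem hu, abs_zero]
    exact (norm_nonneg _).trans (hM 0 (by simp))

/-- The stochastic part of the squared bias is dominated by the optimal rate: either
`h ^ 2 * log n ≤ 1`, or `h` is so large that `h ^ (2 ν)` dominates. -/
lemma IsBandwidth.eventually_mul_log_div_le {h : ℕ → ℝ} (hh : IsBandwidth h) {ν : ℝ}
    (hν : 0 ≤ ν) : ∀ᶠ n : ℕ in atTop,
      h n * Real.log n / n ≤ (n : ℝ)⁻¹ * (h n)⁻¹ + h n ^ (2 * ν) := by
  have hlog : ∀ᶠ n : ℕ in atTop, Real.log n ^ (ν + 1) ≤ n := by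
    have h1 := (isLittleO_log_rpow_rpow_atTop (ν + 1) one_pos).bound one_pos
    filter_upwards [tendsto_natCast_atTop_atTop.eventually h1] with n h2
    rw [Real.rpow_one, one_mul, Real.norm_of_nonneg (by positivity), Real.norm_natCast] at h2
    exact h2
  filter_upwards [hlog, eventually_one_le_log, eventually_ge_atTop 1,
    hh.zero.eventually_le_const one_pos] with n h1 h2 h3 h4
  have hη := hh.pos n
  set η := h n
  set ℓ := Real.log n
  have hn0 : (0 : ℝ) < n := by exact_mod_cast h3
  have hℓ0 : 0 < ℓ := by linarith
  by_cases hc : η ^ 2 * ℓ ≤ 1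
  · have e1 : η * ℓ / n ≤ (n : ℝ)⁻¹ * η⁻¹ := by
      rw [← mul_inv, inv_eq_one_div, div_le_div_iff₀ hn0 (by positivity)]
      nlinarith
    have : 0 ≤ η ^ (2 * ν) := by positivity
    linarith
  · -- here `h ^ (2 ν) ≥ (log n) ^ (-ν)`, which tends to zero more slowly than `log n / n`
    push Not at hc
    have e1 : ℓ⁻¹ ≤ η ^ 2 := by
      rw [inv_eq_one_div, div_le_iff₀ hℓ0]
      exact hc.le
    have e2 : (ℓ ^ ν)⁻¹ ≤ η ^ (2 * ν) := by
      rw [Real.rpow_mul hη.le, ← Real.inv_rpow hℓ0.le]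
      refine Real.rpow_le_rpow (by positivity) ?_ hν
      exact_mod_cast e1
    have e3 : η * ℓ / n ≤ (ℓ ^ ν)⁻¹ := by
      have h5 : 0 < ℓ ^ ν := by positivity
      rw [inv_eq_one_div, div_le_div_iff₀ hn0 h5, one_mul]
      rw [Real.rpow_add_one hℓ0.ne'] at h1
      have : η * ℓ * ℓ ^ ν ≤ 1 * (ℓ ^ ν * ℓ) := by
        rw [mul_assoc, mul_comm ℓ]
        gcongr
      linarith
    have : 0 ≤ (n : ℝ)⁻¹ * η⁻¹ := by positivity
    linarith

/-- At the optimal bandwidth, squared bias and variance are both of order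
`n ^ (-2 ν / (2 ν + 1))`. -/
lemma eventually_rate_le {h : ℕ → ℝ} {ν a b : ℝ} (hν : 0 < ν) (ha : 0 < a) (hb : 0 < b)
    (hab : ∀ᶠ n : ℕ in atTop,
      a * (n : ℝ) ^ (-1 / (2 * ν + 1)) ≤ h n ∧ h n ≤ b * (n : ℝ) ^ (-1 / (2 * ν + 1))) :
    ∀ᶠ n : ℕ in atTop, (n : ℝ)⁻¹ * (h n)⁻¹ + h n ^ (2 * ν) ≤
      (a⁻¹ + b ^ (2 * ν)) * ((n : ℝ) ^ (-ν / (2 * ν + 1))) ^ 2 := by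
  filter_upwards [hab, eventually_ge_atTop 1] with n ⟨h1, h2⟩ hn
  have hn0 : (0 : ℝ) < n := by exact_mod_cast hn
  have hp : 0 < (n : ℝ) ^ (-1 / (2 * ν + 1)) := by positivity
  have hη : 0 < h n := lt_of_lt_of_le (by positivity) h1
  have hsq : ((n : ℝ) ^ (-ν / (2 * ν + 1))) ^ 2 = (n : ℝ) ^ (-(2 * ν) / (2 * ν + 1)) := by
    rw [← Real.rpow_natCast, ← Real.rpow_mul hn0.le]
    congr 1
    push_cast
    ring
  rw [hsq, add_mul]
  refine add_le_add ?_ ?_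
  · have e1 : (h n)⁻¹ ≤ a⁻¹ * ((n : ℝ) ^ (-1 / (2 * ν + 1)))⁻¹ := by
      rw [← mul_inv]
      exact inv_anti₀ (by positivity) h1
    have e2 : (n : ℝ) ^ (-(2 * ν) / (2 * ν + 1)) =
        (n : ℝ)⁻¹ * ((n : ℝ) ^ (-1 / (2 * ν + 1)))⁻¹ := by
      rw [← Real.rpow_neg_one (n : ℝ), ← Real.rpow_neg hn0.le, ← Real.rpow_add hn0]
      congr 1
      have : 2 * ν + 1 ≠ 0 := by positivity
      field_simp
      ring
    rw [e2]
    calc _ ≤ (n : ℝ)⁻¹ * (a⁻¹ * ((n : ℝ) ^ (-1 / (2 * ν + 1)))⁻¹) := by gcongr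
      _ = _ := by ring
  · calc h n ^ (2 * ν) ≤ (b * (n : ℝ) ^ (-1 / (2 * ν + 1))) ^ (2 * ν) := by gcongr
      _ = b ^ (2 * ν) * (n : ℝ) ^ (-(2 * ν) / (2 * ν + 1)) := by
        rw [Real.mul_rpow hb.le hp.le, ← Real.rpow_mul hn0.le]
        congr 2
        ring

/-- Uniform bounds for the bias and for the squared weights of the boosted smoother, with
probability tending to one. -/
theorem exists_bias_weight_bound [IsProbabilityMeasure μ] {X : ℕ → Ω → ℝ} {f m K : ℝ → ℝ}
    {c A : ℝ} (hf : IsDesignDensity f c A)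
    (hX : ∀ i, Measurable (X i))
    (hind : iIndepFun X μ) (hid : ∀ i, IdentDistrib (X i) (X 0) μ μ)
    (hpdf : μ.map (X 0) = volume.withDensity (fun x => ENNReal.ofReal (f x)))
    (hK : IsSmoothingKernel K) {h : ℕ → ℝ} (hh : IsBandwidth h) {ν C₁ C₂ : ℝ} (hν : 2 ≤ ν)
    (hm : m ∈ HolderClass ν C₁) (hmm : Measurable m) {M : ℝ} (hM : ∀ u, |m u| ≤ M)
    (hfH : f ∈ HolderClass (ν - 1) C₂)
    {r : ℕ} (hr : strictFloor (ν / 2) ≤ r) {ε : ℝ} (hε : 0 < ε) :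
    ∃ C, 0 ≤ C ∧ ∃ bad : ℕ → Set Ω, Tendsto (fun n => μ (bad n)) atTop (𝓝 0) ∧
      ∀ᶠ n : ℕ in atTop, ∀ ω ∉ bad n, ∀ x ∈ Icc ε (1 - ε),
        |boostedNW K (h n) (firstN X n ω) (fun i => m (firstN X n ω i)) r x - m x| ≤
          C * (h n ^ ν + √(h n * Real.log n / n)) ∧
        ∑ i, boostWeight K (h n) (firstN X n ω) r x i ^ 2 ≤ C * ((n : ℝ)⁻¹ * (h n)⁻¹) := by
  obtain ⟨L, hL0, hL⟩ := exists_lipschitz_of_holderClass hν hm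
  have hrν : ν ≤ 2 * ((r + 1 : ℕ) : ℝ) := by
    push_cast
    exact le_two_mul_of_strictFloor_le hr
  obtain ⟨Cp, h₀, hh₀, hpop⟩ := exists_abs_iterate_popResidual_le_rpow hK hf.measurable hf.nonneg
    hf.le hf.pos hf.low hmm hM hν hm hfH (r + 1) hrν hε
  have hsub : Icc (ε / 2) (1 - ε / 2) ⊆ Icc (0 : ℝ) 1 :=
    Icc_subset_Icc (by linarith) (by linarith)
  obtain ⟨Ce, hCe, bad, hbad, hev⟩ := exists_good_event hf hX hind hid hpdf hK hh
    (a := ε / 2) (b := 1 - ε / 2) (by linarith) (by linarith) hmm hM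
    (fun u hu v hv => hL u (hsub hu) v (hsub hv)) hL0 (r + 1)
  refine ⟨|Cp| + (2 ^ (r + 1) - 1) * Ce + (2 ^ (r + 1) - 1) ^ 2 * Ce, ?_, bad, hbad, ?_⟩
  · have : (0 : ℝ) ≤ 2 ^ (r + 1) - 1 := sub_nonneg.2 (one_le_pow₀ one_le_two)
    positivity
  -- eventually the `r + 1` steps, which look `h` further each, stay inside `[ε / 2, 1 - ε / 2]`
  have hwin : ∀ᶠ n in atTop, h n ≤ ε / 2 / (r + 1 : ℕ) :=
    hh.zero.eventually_le_const (by positivity)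
  filter_upwards [hev, hh.zero.eventually_le_const hh₀, hwin] with n hev hh₀' hwin ω hω x hx
  obtain ⟨hD, hw, hT⟩ := hev ω hω
  have hη := hh.pos n
  set η := h n
  rw [le_div_iff₀ (by positivity)] at hwin
  have hx1 : x ∈ Icc (ε / 2 + (r + 1 : ℕ) * η) (1 - ε / 2 - (r + 1 : ℕ) * η) := by
    constructor <;> linarith [hx.1, hx.2]
  have hx2 : x ∈ Icc (ε / 2 + r * η) (1 - ε / 2 - r * η) :=
    mem_Icc_of_abs_sub_le hx1 (by simpa using hη.le)
  have h2 : (0 : ℝ) ≤ 2 ^ (r + 1) - 1 := sub_nonneg.2 (one_le_pow₀ one_le_two)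
  have hρ := Real.sqrt_nonneg (η * Real.log n / n)
  set ρ := √(η * Real.log n / n)
  have hην : 0 < η ^ ν := Real.rpow_pos_of_pos hη _
  constructor
  · have e1 := abs_iterate_empResidual_sub_le hK hη hD (popResidual K η f) m (r + 1) hT x hx1
    have e2 := hpop η hη hh₀' x hx
    have e3 : Cp * η ^ ν ≤ |Cp| * η ^ ν := mul_le_mul_of_nonneg_right (le_abs_self _) hην.le
    have e4 : 0 ≤ (2 ^ (r + 1) - 1) * Ce * η ^ ν + (2 ^ (r + 1) - 1) ^ 2 * Ce * (η ^ ν + ρ) +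
      |Cp| * ρ := by positivity
    rw [boostedNW_eq_sub_iterate, sub_sub_cancel_left, abs_neg]
    rw [_root_.abs_le] at e1 e2 ⊢
    constructor <;> linarith
  · refine (sum_sq_boostWeight_le hK hη (by positivity) hD hw r hx2).trans ?_
    have e4 : 0 ≤ (|Cp| + (2 ^ (r + 1) - 1) * Ce) * ((n : ℝ)⁻¹ * η⁻¹) := by positivity
    linarith

end Assembly

theorem theorem3 {Ω : Type*} [MeasurableSpace Ω] (μ : Measure Ω) [IsProbabilityMeasure μ]
    -- i.i.d. observations `(X i, Y i)`
    (X Y : ℕ → Ω → ℝ) (hX : ∀ i, Measurable (X i)) (hY : ∀ i, Measurable (Y i))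
    (hindep : iIndepFun (fun i ω => (X i ω, Y i ω)) μ)
    (hident : ∀ i, IdentDistrib (fun ω => (X i ω, Y i ω)) (fun ω => (X 0 ω, Y 0 ω)) μ μ)
    -- `f` is the density of the covariate, supported on `[0, 1]` and bounded below there
    (f : ℝ → ℝ) (hf_pdf : μ.map (X 0) = volume.withDensity (fun x => ENNReal.ofReal (f x)))
    (hf_supp : ∀ x, x ∉ Icc (0 : ℝ) 1 → f x = 0)
    (hf_low : ∃ c > 0, ∀ x ∈ Icc (0 : ℝ) 1, c ≤ f x)
    -- `m` is the regression function `E(Y | X = ·)`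
    (m : ℝ → ℝ) (hY_int : Integrable (Y 0) μ)
    (hm_reg : μ[Y 0 | MeasurableSpace.comap (X 0) inferInstance] =ᵐ[μ] fun ω => m (X 0 ω))
    -- smoothness
    (ν C₁ C₂ : ℝ) (hν : 2 ≤ ν) (hm : m ∈ HolderClass ν C₁) (hf : f ∈ HolderClass (ν - 1) C₂)
    -- kernel and bandwidth
    (K : ℝ → ℝ) (hK : IsSmoothingKernel K)
    (h : ℕ → ℝ) (hh_pos : ∀ n, 0 < h n) (hh_zero : Tendsto h atTop (𝓝 0))
    (hh_large : Tendsto (fun n : ℕ => (n : ℝ) * h n / Real.log n) atTop atTop)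
    -- number of boosting steps
    (r : ℕ) (hr : strictFloor (ν / 2) ≤ r) :
    -- the conditional bias
    (∀ ε > 0, IsBigOpUniformly μ (Icc ε (1 - ε)) (condBias μ X Y m K h r)
      (fun n => h n ^ ν + √(h n * Real.log n / n))) ∧
    -- the conditional mean squared error, when the conditional variance of `Y` is bounded
    (∀ B : ℝ, MemLp (Y 0) 2 μ →
      (∀ᵐ ω ∂μ, condVar (MeasurableSpace.comap (X 0) inferInstance) (Y 0) μ ω ≤ B) →
      (∀ ε > 0, IsBigOpUniformly μ (Icc ε (1 - ε)) (condMSE μ X Y m K h r)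
        (fun n => (n : ℝ)⁻¹ * (h n)⁻¹ + h n ^ (2 * ν))) ∧
      ((∃ a > 0, ∃ b > 0, ∀ᶠ n : ℕ in atTop,
          a * (n : ℝ) ^ (-1 / (2 * ν + 1)) ≤ h n ∧ h n ≤ b * (n : ℝ) ^ (-1 / (2 * ν + 1))) →
        ∀ ε > 0, IsBigOpUniformly μ (Icc ε (1 - ε))
          (fun n x ω => √(condMSE μ X Y m K h r n x ω))
          (fun n => (n : ℝ) ^ (-ν / (2 * ν + 1))))) := by
  obtain ⟨c, hc, hf_low⟩ := hf_low
  have hf0 : ∀ u, 0 ≤ f u := fun u => by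
    by_cases hu : u ∈ Icc (0 : ℝ) 1
    · exact hc.le.trans (hf_low u hu)
    · exact (hf_supp u hu).ge
  have hf_ind : (Icc (0 : ℝ) 1).indicator f = f :=
    indicator_eq_self.2 fun u hu => by_contra fun hu' => hu (hf_supp u hu')
  have hfm : Measurable f := hf_ind ▸ measurable_indicator_of_holderClass hf
  obtain ⟨A, hA⟩ := exists_bound_indicator_of_holderClass hf
  rw [hf_ind] at hA
  have hdes : IsDesignDensity f c A :=
    ⟨hfm, hf0, fun u => (le_abs_self _).trans (hA u), hc, hf_low⟩
  have hbw : IsBandwidth h := ⟨hh_pos, hh_zero, hh_large⟩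
  have hindX : iIndepFun X μ := hindep.comp (fun _ p => p.1) fun _ => measurable_fst
  have hidX : ∀ i, IdentDistrib (X i) (X 0) μ μ := fun i => (hident i).comp measurable_fst
  -- `m` is only controlled on `[0, 1]`, where the design lives; replace it by `0` elsewhere
  set m' := (Icc (0 : ℝ) 1).indicator m with hm'
  have hm'm : Measurable m' := measurable_indicator_of_holderClass hm
  obtain ⟨M, hM⟩ := exists_bound_indicator_of_holderClass hm
  have hmEq : ∀ x ∈ Icc (0 : ℝ) 1, m' x = m x := fun x hx => indicator_of_mem hx m
  have hm'H : m' ∈ HolderClass ν C₁ := HolderClass.congr hm hmEq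
  have hX01 : ∀ᵐ ω ∂μ, X 0 ω ∈ Icc (0 : ℝ) 1 := by
    refine ae_of_ae_map (hX 0).aemeasurable (p := fun x => x ∈ Icc (0 : ℝ) 1) ?_
    rw [hf_pdf, ae_withDensity_iff (by fun_prop)]
    refine Eventually.of_forall fun x hx => by_contra fun hx' => hx ?_
    rw [hf_supp x hx', ENNReal.ofReal_zero]
  have hm'_reg : μ[Y 0 | MeasurableSpace.comap (X 0) inferInstance] =ᵐ[μ]
      fun ω => m' (X 0 ω) := by
    filter_upwards [hm_reg, hX01] with ω h1 h2
    rw [h1, hmEq _ h2]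
  have hIcc : ∀ ε > 0, ∀ x ∈ Icc ε (1 - ε), m' x = m x := fun ε hε x hx =>
    hmEq x ⟨hε.le.trans hx.1, by linarith [hx.2]⟩
  refine ⟨fun ε hε => ?_, fun B hY2 hvar => ?_⟩
  · obtain ⟨C, -, bad, hbad, hev⟩ := exists_bias_weight_bound hdes hX hindX hidX hf_pdf hK hbw hν
      hm'H hm'm hM hf hr hε
    refine isBigOpUniformly_of_bad (C := C) hbad ?_
    filter_upwards [hev] with n hev
    filter_upwards [ae_condMeanGiven_boostedNW hX hY hindep hident hm'm hY_int hm'_reg K (h n) r n]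
      with ω h1 hω x hx
    rw [condBias, h1 x, ← hIcc ε hε x hx]
    exact (hev ω hω x hx).1
  have hMSE : ∀ ε > 0, IsBigOpUniformly μ (Icc ε (1 - ε)) (condMSE μ X Y m K h r)
      (fun n => (n : ℝ)⁻¹ * (h n)⁻¹ + h n ^ (2 * ν)) := by
    intro ε hε
    obtain ⟨C, hC, bad, hbad, hev⟩ := exists_bias_weight_bound hdes hX hindX hidX hf_pdf hK hbw hν
      hm'H hm'm hM hf hr hε
    refine isBigOpUniformly_of_bad (C := |B| * C + 4 * C ^ 2) hbad ?_
    filter_upwards [hev, hbw.eventually_mul_log_div_le (by linarith : 0 ≤ ν)] with n hev hrate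
    filter_upwards [ae_condMeanGiven_sq_le hX hY hindep hident hm'm hm'_reg hY2 hvar K (h n) r n]
      with ω h1 hω x hx
    have hη := hh_pos n
    have hnn : 0 ≤ condMSE μ X Y m K h r n x ω :=
      integral_nonneg fun v => sq_nonneg (boostedNW K (h n) (firstN X n ω) v r x - m x)
    rw [abs_of_nonneg hnn]
    obtain ⟨hb, hw⟩ := hev ω hω x hx
    rw [hIcc ε hε x hx] at hb
    refine (h1 x (m x)).trans ?_
    set W := ∑ i, boostWeight K (h n) (firstN X n ω) r x i ^ 2 with hW
    have hW0 : 0 ≤ W := Finset.sum_nonneg fun i _ => sq_nonneg _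
    set η := h n
    set V := (n : ℝ)⁻¹ * η⁻¹ with hV
    have hV0 : 0 ≤ V := by positivity
    have hq : (0 : ℝ) ≤ η * Real.log n / n := by positivity
    have hsq : η ^ (2 * ν) = (η ^ ν) ^ 2 := by
      rw [mul_comm, Real.rpow_mul hη.le]
      norm_cast
    have e1 : B * W ≤ |B| * C * V := by
      calc B * W ≤ |B| * W := mul_le_mul_of_nonneg_right (le_abs_self B) hW0
        _ ≤ |B| * (C * V) := mul_le_mul_of_nonneg_left hw (abs_nonneg B)
        _ = _ := by ring
    have e2 := pow_le_pow_left₀ (abs_nonneg _) hb 2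
    rw [sq_abs, mul_pow] at e2
    have e3 : (η ^ ν + √(η * Real.log n / n)) ^ 2 ≤ 4 * (V + η ^ (2 * ν)) := by
      have e4 := Real.sq_sqrt hq
      have e5 : 0 ≤ η ^ (2 * ν) := by positivity
      nlinarith [sq_nonneg (η ^ ν - √(η * Real.log n / n))]
    have e6 := mul_le_mul_of_nonneg_left e3 (sq_nonneg C)
    have e7 : 0 ≤ |B| * C * η ^ (2 * ν) := by positivity
    linarith
  refine ⟨hMSE, ?_⟩
  rintro ⟨a, ha, b, hb, hab⟩ ε hε η hη
  obtain ⟨M₀, hM₀⟩ := hMSE ε hε η hη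
  refine ⟨√(|M₀| * (a⁻¹ + b ^ (2 * ν))), ?_⟩
  filter_upwards [hM₀, eventually_rate_le (by linarith : 0 < ν) ha hb hab] with n h1 h2
  refine (measure_mono ?_).trans h1
  rintro ω ⟨x, hx, hlt⟩
  refine ⟨x, hx, ?_⟩
  have hrt : (0 : ℝ) ≤ (n : ℝ) ^ (-ν / (2 * ν + 1)) := by positivity
  have hk : 0 ≤ |M₀| * (a⁻¹ + b ^ (2 * ν)) := by positivity
  rw [abs_of_nonneg (Real.sqrt_nonneg _)] at hlt
  have h3 : |M₀| * (a⁻¹ + b ^ (2 * ν)) * ((n : ℝ) ^ (-ν / (2 * ν + 1))) ^ 2 <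
      condMSE μ X Y m K h r n x ω := by
    have := Real.lt_sqrt (by positivity) |>.1 hlt
    rwa [mul_pow, Real.sq_sqrt hk] at this
  have h4 : 0 ≤ (n : ℝ)⁻¹ * (h n)⁻¹ + h n ^ (2 * ν) := by
    have := hh_pos n
    positivity
  calc M₀ * ((n : ℝ)⁻¹ * (h n)⁻¹ + h n ^ (2 * ν))
      ≤ |M₀| * ((n : ℝ)⁻¹ * (h n)⁻¹ + h n ^ (2 * ν)) :=
        mul_le_mul_of_nonneg_right (le_abs_self _) h4
    _ ≤ |M₀| * ((a⁻¹ + b ^ (2 * ν)) * ((n : ℝ) ^ (-ν / (2 * ν + 1))) ^ 2) :=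
        mul_le_mul_of_nonneg_left h2 (abs_nonneg _)
    _ < condMSE μ X Y m K h r n x ω := by rwa [← mul_assoc]
    _ ≤ _ := le_abs_self _
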